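/- Let $B$ be the Killing form of $\mathfrak u=\mathfrak{so}(3)$, let $g_0$ be the bi-invariant metric on $\operatorname{SO}(3)$ induced by $-B$, with norm $\|\cdot\|_0$ on $\mathfrak u$, and let $\Theta_1,\Theta_2,\Theta_3$ be the $g_0$-orthonormal basis of $\mathfrak u$ in which $\Theta_j$ is $1/\sqrt2$ times the infinitesimal rotation about the $j$-th coordinate axis. For $\alpha,A>0$ let $g_{(\alpha,\alpha,A)}$ be the left-invariant Riemannian metric on $\operatorname{SO}(3)$ given on $\mathfrak u=T_e\operatorname{SO}(3)$ by $\langle v,w\rangle=-B(\Omega v,w)$, where $\Omega\Theta_1=\alpha\Theta_1$, $\Omega\Theta_2=\alpha\Theta_2$, $\Omega\Theta_3=A\Theta_3$. Put $\ell_0=2\sqrt2\,\pi$, $\mathfrak K=\operatorname{Span}(\Theta_3)$ and $\mathfrak m=\mathfrak K^{\perp}$ (with respect to $g_0$). A closed geodesic is a periodic geodesic $\gamma:\mathbb R\to\operatorname{SO}(3)$; constant ones are allowed. The primitive length of a non-constant closed geodesic is its length over its least positive period. The length spectrum $\operatorname{Spec}_L(g)$ is the set of lengths of all closed geodesics (once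 or multiply traversed, constant ones included). A one-parameter subgroup is a smooth homomorphism $\mathbb R\to\operatorname{SO}(3)$. In what follows $p,q$ denote positive integers. For $\alpha\ne A$ put $\overline A=\frac{A\alpha}{\alpha-A}$, $\mathfrak p_1=\{(X,0):X\in\mathfrak m\}$, $\mathfrak q_0=\{(\overline A Z,-\alpha Z):Z\in\mathfrak K\}$, $\mathfrak p=\mathfrak p_1\oplus\mathfrak q_0\subset\mathfrak u\times\mathfrak u$, and $\gamma_{(V,W)}(t)=\exp(tV)\exp(-tW)$ for $(V,W)\in\mathfrak p$. For $\tau>0$ let $\mathcal E_{\tau,\alpha,A}$ be the set of ordered pairs $(p,q)$ of relatively prime positive integers with $\frac qp>\left|\frac{A}{A-\alpha}\right|$ and $\sqrt\alpha\,\ell_0\left(q^2+p^2\frac{A}{\alpha-A}\right)^{1/2}=\tau$. 1. If $\alpha=A$, then the closed geodesics $\gamma$ of $g_{(\alpha,\alpha,A)}$ with $\gamma(0)=e$ are precisely the one-parameter subgroups of $\operatorname{SO}(3)$, and every non-constant closed geodesic has primitive length $\sqrt A\,\ell_0$. 2. If $\alpha\neq A$, then for every $(V,W)\in\mathfrak p$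 the curve $\gamma_{(V,W)}$ is a geodesic with $\gamma_{(V,W)}(0)=e$ and $\gamma_{(V,W)}'(0)=V-W$, and every geodesic $\gamma$ with $\gamma(0)=e$ equals $\gamma_{(V,W)}$ for exactly one $(V,W)\in\mathfrak p$. For $(V,W)\in\mathfrak p$ the geodesic $\gamma_{(V,W)}$ is closed if and only if one of the following holds: (a) $(V,W)\in\mathfrak p_1$ (Type I); then $\gamma_{(V,W)}$ is a one-parameter subgroup, of primitive length $\sqrt\alpha\,\ell_0$ if $(V,W)\ne0$. (b) $(V,W)\in\mathfrak q_0$ (Type II); then $\gamma_{(V,W)}$ is a one-parameter subgroup, of primitive length $\sqrt A\,\ell_0$ if $(V,W)\ne0$. (c) $(V,W)=(X+\overline A Z,-\alpha Z)$ with $0\ne X\in\mathfrak m$ and $0\neq Z\in\mathfrak K$, and there are relatively prime positive integers $p,q$ with $\frac{q^2}{p^2}>\frac{A^2}{(A-\alpha)^2}$ and $\|X\|_0^2=\left(\frac{q^2\alpha^2}{p^2}-\frac{A^2\alpha^2}{(\alpha-A)^2}\right)\|Z\|_0^2$ (Type III); then $\gamma_{(V,W)}$ is not a one-parameter subgroup,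 and its primitive length is $\sqrt\alpha\,\ell_0\left(q^2+p^2\frac{A}{\alpha-A}\right)^{1/2}$, which is strictly larger than $\sqrt\alpha\,\ell_0$. 3. Consequently, $\operatorname{Spec}_L(g_{(\alpha,\alpha,A)})=\{0\}\cup\{k\sqrt\alpha\,\ell_0:k\in\mathbb N\}$ if $\alpha=A$, and $$\operatorname{Spec}_L(g_{(\alpha,\alpha,A)})=\{0\}\cup\{k\sqrt\alpha\,\ell_0,\;k\sqrt A\,\ell_0,\;k\tau:\ k\in\mathbb N,\ \tau>0\text{ with }\mathcal E_{\tau,\alpha,A}\neq\emptyset\}$$ if $\alpha\ne A$. Moreover, if $\alpha\neq A$, then $\mathcal E_{\tau,\alpha,A}$ is finite for every $\tau>0$. -/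

import Mathlib

open scoped Matrix ContDiff

noncomputable section

namespace SO3Geodesics

/-! ### The Lie group `SO(3)`, its Lie algebra and its exponential map -/

/-- The Lie group `SO(3)`. -/
abbrev SO3 : Type := Matrix.specialOrthogonalGroup (Fin 3) ℝ

/-- The Lie algebra `𝔲 = 𝔰𝔬(3)` of skew-symmetric matrices. -/
abbrev so3 : Type := LieAlgebra.Orthogonal.so (Fin 3) ℝ

theorem exp_transpose_mul (X : so3) :
    (NormedSpace.exp (X : Matrix (Fin 3) (Fin 3) ℝ))ᵀ *
      NormedSpace.exp (X : Matrix (Fin 3) (Fin 3) ℝ) = 1 := by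
  have hX : (X : Matrix (Fin 3) (Fin 3) ℝ)ᵀ = -(X : Matrix (Fin 3) (Fin 3) ℝ) :=
    (LieAlgebra.Orthogonal.mem_so (Fin 3) ℝ _).1 X.2
  rw [← Matrix.exp_transpose, hX, Matrix.exp_neg]
  exact Matrix.nonsing_inv_mul _ ((Matrix.isUnit_iff_isUnit_det _).1 (Matrix.isUnit_exp _))

theorem exp_mem_SO3 (X : so3) :
    NormedSpace.exp (X : Matrix (Fin 3) (Fin 3) ℝ) ∈
      Matrix.specialOrthogonalGroup (Fin 3) ℝ := by
  rw [Matrix.mem_specialOrthogonalGroup_iff]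
  refine ⟨(Matrix.mem_orthogonalGroup_iff' (Fin 3) ℝ).2 (exp_transpose_mul X), ?_⟩
  have h1 := congrArg Matrix.det (exp_transpose_mul X)
  rw [Matrix.det_mul, Matrix.det_transpose, Matrix.det_one] at h1
  have h2 : NormedSpace.exp (X : Matrix (Fin 3) (Fin 3) ℝ) =
      NormedSpace.exp ((1 / 2 : ℝ) • (X : Matrix (Fin 3) (Fin 3) ℝ)) *
        NormedSpace.exp ((1 / 2 : ℝ) • (X : Matrix (Fin 3) (Fin 3) ℝ)) := by
    rw [← Matrix.exp_add_of_commute _ _ (Commute.refl _), ← add_smul]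
    norm_num
  have h3 := congrArg Matrix.det h2
  rw [Matrix.det_mul] at h3
  nlinarith [mul_self_nonneg
    (NormedSpace.exp ((1 / 2 : ℝ) • (X : Matrix (Fin 3) (Fin 3) ℝ))).det]

/-- The exponential map `exp : 𝔰𝔬(3) → SO(3)`, i.e. the matrix exponential. -/
def expSO3 (X : so3) : SO3 := ⟨NormedSpace.exp (X : Matrix (Fin 3) (Fin 3) ℝ), exp_mem_SO3 X⟩

/-! ### The metrics `g_{(c₁,c₂,c₃)}` -/

/-- The inner product `-B` on `𝔰𝔬(3)`, where `B` is the Killing form; left translation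
turns it into the bi-invariant metric `g₀`. -/
def g0 : LinearMap.BilinForm ℝ so3 := -killingForm ℝ so3

/-- The standard `g₀`-orthonormal basis `Θ₁, Θ₂, Θ₃` of `𝔰𝔬(3)`: `Θ_j` is `1/√2` times the
infinitesimal rotation about the `j`-th coordinate axis (index `j = 0, 1, 2` in the code). -/
def Theta (j : Fin 3) : so3 :=
  (1 / √2 : ℝ) •
    (⟨![!![0, 0, 0; 0, 0, -1; 0, 1, 0],
        !![0, 0, 1; 0, 0, 0; -1, 0, 0],
        !![0, -1, 0; 1, 0, 0; 0, 0, 0]] j, by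
      rw [LieAlgebra.Orthogonal.mem_so]
      fin_cases j <;> ext a b <;> fin_cases a <;> fin_cases b <;> simp⟩ : so3)

/-- The self-adjoint operator `Ω` with `Ω Θ_j = c_j Θ_j`. -/
def Omega (c : Fin 3 → ℝ) : so3 →ₗ[ℝ] so3 :=
  ∑ j, c j • (g0 (Theta j)).smulRight (Theta j)

/-- The inner product `⟨x, y⟩ = -B(Ω x, y)` on `𝔰𝔬(3) = T_e SO(3)`.  The left-invariant
Riemannian metric `g_{(c₁,c₂,c₃)}` is given by `g_u(uX, uY) = ⟨X, Y⟩`. -/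
def metric (c : Fin 3 → ℝ) : LinearMap.BilinForm ℝ so3 := g0 ∘ₗ Omega c

/-! ### Curves, lengths, the Levi-Civita connection, geodesics

The tangent bundle of `SO(3)` is trivialised by left translations: `X ∈ 𝔰𝔬(3)` stands for the
tangent vector `uX ∈ T_u SO(3)`. -/

/-- `γ : ℝ → SO(3)` is a smooth curve. -/
def SmoothCurve (γ : ℝ → SO3) : Prop :=
  ∀ i j, ContDiff ℝ ∞ fun t => (γ t : Matrix (Fin 3) (Fin 3) ℝ) i j

/-- The matrix `γ'(t)`. -/
def velocity (γ : ℝ → SO3) (t : ℝ) : Matrix (Fin 3) (Fin 3) ℝ :=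
  Matrix.of fun i j => deriv (fun s => (γ s : Matrix (Fin 3) (Fin 3) ℝ) i j) t

theorem transpose_mul_velocity_mem (γ : ℝ → SO3) (hγ : SmoothCurve γ) (t : ℝ) :
    (γ t : Matrix (Fin 3) (Fin 3) ℝ)ᵀ * velocity γ t ∈ LieAlgebra.Orthogonal.so (Fin 3) ℝ := by
  rw [LieAlgebra.Orthogonal.mem_so]
  have hd : ∀ i j, HasDerivAt (fun s => (γ s : Matrix (Fin 3) (Fin 3) ℝ) i j)
      (velocity γ t i j) t := fun i j =>
    (((hγ i j).differentiable (by simp)) t).hasDerivAt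
  have ho : ∀ s, (γ s : Matrix (Fin 3) (Fin 3) ℝ)ᵀ * (γ s : Matrix (Fin 3) (Fin 3) ℝ) = 1 :=
    fun s => (Matrix.mem_orthogonalGroup_iff' (Fin 3) ℝ).1
      (Matrix.mem_specialOrthogonalGroup_iff.1 (γ s).2).1
  ext a b
  have h1 : HasDerivAt (fun s => ∑ k, (γ s : Matrix (Fin 3) (Fin 3) ℝ) k a *
      (γ s : Matrix (Fin 3) (Fin 3) ℝ) k b)
      (∑ k, (velocity γ t k a * (γ t : Matrix (Fin 3) (Fin 3) ℝ) k b +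
        (γ t : Matrix (Fin 3) (Fin 3) ℝ) k a * velocity γ t k b)) t :=
    HasDerivAt.fun_sum fun k _ => (hd k a).mul (hd k b)
  have h2 : (fun s => ∑ k, (γ s : Matrix (Fin 3) (Fin 3) ℝ) k a *
      (γ s : Matrix (Fin 3) (Fin 3) ℝ) k b) =
        fun _ => (1 : Matrix (Fin 3) (Fin 3) ℝ) a b := by
    funext s
    rw [← ho s]
    simp [Matrix.mul_apply]
  rw [h2] at h1
  have h3 := h1.unique (hasDerivAt_const t _)
  simp only [Matrix.transpose_apply, Matrix.mul_apply, Matrix.neg_apply]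
  rw [Finset.sum_add_distrib] at h3
  have h4 := eq_neg_of_add_eq_zero_left h3
  rw [← h4]
  exact Finset.sum_congr rfl fun k _ => mul_comm _ _

open Classical in
/-- The velocity of `γ` in the left trivialisation: `γ'(t) = γ(t) ω(t)` with
`ω(t) = γ(t)⁻¹ γ'(t) ∈ 𝔰𝔬(3)`.  For a smooth curve the first case always applies, by
`transpose_mul_velocity_mem`. -/
def leftVelocity (γ : ℝ → SO3) (t : ℝ) : so3 :=
  if h : (γ t : Matrix (Fin 3) (Fin 3) ℝ)ᵀ * velocity γ t ∈ LieAlgebra.Orthogonal.so (Fin 3) ℝ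
  then ⟨_, h⟩ else 0

/-- The Riemannian length of `γ` restricted to `[a, b]` for the left-invariant metric `g`. -/
def arcLength (g : LinearMap.BilinForm ℝ so3) (γ : ℝ → SO3) (a b : ℝ) : ℝ :=
  ∫ t in a..b, √(g (leftVelocity γ t) (leftVelocity γ t))

/-- In the left trivialisation a vector field is a map `Y : SO(3) → 𝔰𝔬(3)`, and an arbitrary
affine connection has the form `(∇_X Y)(u) = (X·Y)(u) + Γ_u(X(u), Y(u))`, where `X·Y` is the
derivative of the function `Y` along `X`.  Since the Lie bracket of vector fields is
`X·Y - Y·X + [X, Y]` (with the pointwise bracket of `𝔰𝔬(3)`) and the function `g(Y, Z)` has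
derivative `g(X·Y, Z) + g(Y, X·Z)` along `X`, the connection is torsion-free, respectively
compatible with the left-invariant metric `g`, exactly if the first, respectively the second,
condition below holds. -/
structure IsLeviCivita (g : LinearMap.BilinForm ℝ so3)
    (Γ : SO3 → so3 →ₗ[ℝ] so3 →ₗ[ℝ] so3) : Prop where
  torsion_free : ∀ u x y, Γ u x y - Γ u y x = ⁅x, y⁆
  metric_compatible : ∀ u x y z, g (Γ u x y) z + g y (Γ u x z) = 0

/-- The covariant derivative `∇_{γ'} Y` at time `t` of a vector field `Y` along `γ`
(in the left trivialisation), for the connection with coefficients `Γ`. -/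
def covDeriv (Γ : SO3 → so3 →ₗ[ℝ] so3 →ₗ[ℝ] so3) (γ : ℝ → SO3) (Y : ℝ → so3) (t : ℝ) :
    Matrix (Fin 3) (Fin 3) ℝ :=
  (Matrix.of fun i j => deriv (fun s => (Y s : Matrix (Fin 3) (Fin 3) ℝ) i j) t) +
    (Γ (γ t) (leftVelocity γ t) (Y t) : so3)

/-- `γ : ℝ → SO(3)` is a geodesic of the left-invariant metric `g`: it is smooth and
`∇_{γ'} γ' = 0` for the Levi-Civita connection of `g`. -/
def IsGeodesic (g : LinearMap.BilinForm ℝ so3) (γ : ℝ → SO3) : Prop :=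
  SmoothCurve γ ∧ ∃ Γ, IsLeviCivita g Γ ∧ ∀ t, covDeriv Γ γ (leftVelocity γ) t = 0

/-- A (smoothly) closed geodesic: a geodesic `ℝ → SO(3)` which is periodic.
Constant curves are allowed. -/
def IsClosedGeodesic (g : LinearMap.BilinForm ℝ so3) (γ : ℝ → SO3) : Prop :=
  IsGeodesic g γ ∧ ∃ T : ℝ, 0 < T ∧ Function.Periodic γ T

/-- The curve `γ` has a least positive period `T`, and its length over one such period is `L`. -/
def HasPrimitiveLength (g : LinearMap.BilinForm ℝ so3) (γ : ℝ → SO3) (L : ℝ) : Prop :=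
  ∃ T : ℝ, IsLeast {S : ℝ | 0 < S ∧ Function.Periodic γ S} T ∧ arcLength g γ 0 T = L

/-- The length spectrum: the set of lengths of all closed geodesics (traversed once or several
times; constant ones included). -/
def lengthSpectrum (g : LinearMap.BilinForm ℝ so3) : Set ℝ :=
  {L | ∃ (γ : ℝ → SO3) (T : ℝ),
    IsGeodesic g γ ∧ 0 < T ∧ Function.Periodic γ T ∧ arcLength g γ 0 T = L}

/-- A one-parameter subgroup: a smooth homomorphism `ℝ → SO(3)`. -/
def IsOneParameterSubgroup (γ : ℝ → SO3) : Prop :=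
  SmoothCurve γ ∧ ∀ s t, γ (s + t) = γ s * γ t

/-! ### The naturally reductive metrics `g_{(α,α,A)}` -/

/-- The metric `g_{(α,α,A)}`. -/
def gNat (α A : ℝ) : LinearMap.BilinForm ℝ so3 := metric ![α, α, A]

/-- `ℓ₀ = 2√2 π`. -/
def ell0 : ℝ := 2 * √2 * Real.pi

/-- `𝔎 = Span(Θ₃)`. -/
def frakK : Submodule ℝ so3 := Submodule.span ℝ {Theta 2}

/-- `𝔪 = 𝔎^⊥`, the orthogonal complement with respect to `g₀`. -/
def frakM : Submodule ℝ so3 := g0.orthogonal frakK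

/-- `Ā = Aα/(α - A)`, used for `α ≠ A` only. -/
def Abar (α A : ℝ) : ℝ := A * α / (α - A)

/-- `𝔭₁ = {(X, 0) : X ∈ 𝔪}`. -/
def frakP1 : Submodule ℝ (so3 × so3) := frakM.prod ⊥

/-- `𝔮₀ = {(Ā Z, -α Z) : Z ∈ 𝔎}`. -/
def frakQ0 (α A : ℝ) : Submodule ℝ (so3 × so3) :=
  frakK.map ((Abar α A • LinearMap.id : so3 →ₗ[ℝ] so3).prod (-α • LinearMap.id))

/-- `𝔭 = 𝔭₁ ⊕ 𝔮₀`, for `α ≠ A`. -/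
def frakP (α A : ℝ) : Submodule ℝ (so3 × so3) := frakP1 ⊔ frakQ0 α A

/-- The curve `γ_{(V,W)}(t) = exp(tV) exp(-tW)`. -/
def gammaVW (VW : so3 × so3) (t : ℝ) : SO3 := expSO3 (t • VW.1) * expSO3 (-(t • VW.2))

/-- `σ(p,q,α,A) = q²α²/p² - A²α²/(α - A)²`. -/
def sigma (p q : ℕ) (α A : ℝ) : ℝ :=
  (q : ℝ) ^ 2 * α ^ 2 / (p : ℝ) ^ 2 - A ^ 2 * α ^ 2 / (α - A) ^ 2

/-- `(V, W) = (X + Ā Z, -α Z)` with `0 ≠ X ∈ 𝔪`, `0 ≠ Z ∈ 𝔎`, and `p, q` are relatively prime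
positive integers with `q²/p² > A²/(A - α)²` and `‖X‖₀² = σ(p,q,α,A) ‖Z‖₀²`. -/
def IsTypeIII (α A : ℝ) (p q : ℕ) (VW : so3 × so3) : Prop :=
  0 < p ∧ 0 < q ∧ Nat.Coprime p q ∧
    (q : ℝ) ^ 2 / (p : ℝ) ^ 2 > A ^ 2 / (A - α) ^ 2 ∧
    ∃ X ∈ frakM, ∃ Z ∈ frakK, X ≠ 0 ∧ Z ≠ 0 ∧
      VW = (X + Abar α A • Z, -(α • Z)) ∧ g0 X X = sigma p q α A * g0 Z Z

/-- `√α ℓ₀ (q² + p² A/(α - A))^{1/2}`. -/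
def lengthIII (α A : ℝ) (p q : ℕ) : ℝ :=
  √α * ell0 * √((q : ℝ) ^ 2 + (p : ℝ) ^ 2 * (A / (α - A)))

/-- The set `ℰ_{τ,α,A}` of ordered pairs `(p, q)` of relatively prime positive integers with
`q/p > |A/(A - α)|` and `√α ℓ₀ (q² + p² A/(α - A))^{1/2} = τ`. -/
def calE (τ α A : ℝ) : Set (ℕ × ℕ) :=
  {pq | 0 < pq.1 ∧ 0 < pq.2 ∧ Nat.Coprime pq.1 pq.2 ∧
    (pq.2 : ℝ) / (pq.1 : ℝ) > |A / (A - α)| ∧ lengthIII α A pq.1 pq.2 = τ}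

end SO3Geodesics

end

open SO3Geodesics

/-! Under the identification of 𝔰𝔬(3) with ℝ³, the bracket is the cross product and `-B` is twice
the dot product. The Koszul argument turns the geodesic equation into Euler's equation for the left
velocity v (`isGeodesic_iff`). For two equal moments α this reads v' = W × v with W = (0, 0,
-((α-A)/α) v₂), and v₂ is conserved. So v rotates uniformly about the third axis, and undoing this
rotation leaves a linear equation with constant coefficients. Its solution through e is exp(tV)
exp(-tW) with V = v + W (`isGeodesic_gammaVW`, `IsGeodesic.eq_gammaVW`).

T is a period exactly when exp(TV) = exp(TW). If W = 0, or if V and W are both on the third axis,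
the curve is a one-parameter subgroup, and for nonzero velocity its least period is 2π over the
Euclidean norm of V - W. Otherwise the two rotations have different axes and can agree only if both
are trivial (`exp_eq_one_of_exp_eq`), so T|V| and T|W| both lie in 2πℤ. Hence |V|/|W| is a rational
q/p in lowest terms, which is the condition involving `sigma`, and the least period is 2πp/|W|
(`isLeast_period_of_coprime`). Speed is constant, so lengths are speed times period.

Left translation reduces the length spectrum to geodesics through e, and every period is a multiple
of the least one. Elementary estimates on q² + p²A/(α-A) (`typeIII_estimate`) give both the strict
inequality for Type III and the finiteness of `calE`. -/

noncomputable section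

namespace SO3Geodesics

/-! ### The identification of `𝔰𝔬(3)` with `ℝ³` -/

/-- The cross product matrix of `v`. -/
def crossMatrix (v : Fin 3 → ℝ) : Matrix (Fin 3) (Fin 3) ℝ :=
  !![0, -v 2, v 1; v 2, 0, -v 0; -v 1, v 0, 0]

theorem crossMatrix_mem (v : Fin 3 → ℝ) :
    crossMatrix v ∈ LieAlgebra.Orthogonal.so (Fin 3) ℝ := by
  rw [LieAlgebra.Orthogonal.mem_so]
  ext a b
  fin_cases a <;> fin_cases b <;> simp [crossMatrix]

theorem crossMatrix_add (u v : Fin 3 → ℝ) :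
    crossMatrix (u + v) = crossMatrix u + crossMatrix v := by
  ext a b
  fin_cases a <;> fin_cases b <;> simp [crossMatrix, add_comm]

theorem crossMatrix_smul (r : ℝ) (v : Fin 3 → ℝ) :
    crossMatrix (r • v) = r • crossMatrix v := by
  ext a b
  fin_cases a <;> fin_cases b <;> simp [crossMatrix]

theorem crossMatrix_of_skew {x : Matrix (Fin 3) (Fin 3) ℝ} (h : xᵀ = -x) :
    crossMatrix ![x 2 1, x 0 2, x 1 0] = x := by
  have h' : ∀ i j, x j i = -x i j := fun i j => congrFun (congrFun h i) j
  have h0 : ∀ i, x i i = 0 := fun i => by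
    have := h' i i
    linarith
  ext a b
  fin_cases a <;> fin_cases b <;> simp [crossMatrix, h0]
  · exact (h' 1 0).symm
  · exact (h' 2 1).symm
  · exact (h' 0 2).symm

/-- The linear isomorphism `ℝ³ ≃ 𝔰𝔬(3)` sending `v` to the infinitesimal rotation `v × ·`. -/
def hat : (Fin 3 → ℝ) ≃ₗ[ℝ] so3 where
  toFun v := ⟨crossMatrix v, crossMatrix_mem v⟩
  map_add' u v := Subtype.ext (crossMatrix_add u v)
  map_smul' r v := Subtype.ext (crossMatrix_smul r v)
  invFun x := ![(x : Matrix (Fin 3) (Fin 3) ℝ) 2 1, (x : Matrix (Fin 3) (Fin 3) ℝ) 0 2,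
    (x : Matrix (Fin 3) (Fin 3) ℝ) 1 0]
  left_inv v := by
    ext a
    fin_cases a <;> simp [crossMatrix]
  right_inv x := Subtype.ext
    (crossMatrix_of_skew ((LieAlgebra.Orthogonal.mem_so (Fin 3) ℝ _).1 x.2))

theorem coe_hat (v : Fin 3 → ℝ) : (hat v : Matrix (Fin 3) (Fin 3) ℝ) = crossMatrix v := rfl

theorem hat_symm_apply (x : so3) :
    hat.symm x = ![(x : Matrix (Fin 3) (Fin 3) ℝ) 2 1, (x : Matrix (Fin 3) (Fin 3) ℝ) 0 2,
      (x : Matrix (Fin 3) (Fin 3) ℝ) 1 0] := rfl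

theorem crossMatrix_mul_sub (u v : Fin 3 → ℝ) :
    crossMatrix u * crossMatrix v - crossMatrix v * crossMatrix u = crossMatrix (u ⨯₃ v) := by
  ext a b
  fin_cases a <;> fin_cases b <;>
    simp [crossMatrix, cross_apply] <;> ring

theorem bracket_hat (u v : Fin 3 → ℝ) : ⁅hat u, hat v⁆ = hat (u ⨯₃ v) := by
  apply Subtype.ext
  rw [coe_hat, ← crossMatrix_mul_sub]
  rfl

/-- Conjugating by `hat`, ad ∘ ad becomes x ↦ u × (v × x), whose trace is -2 u·v. -/
theorem g0_hat (u v : Fin 3 → ℝ) :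
    g0 (hat u) (hat v) = 2 * (u 0 * v 0 + u 1 * v 1 + u 2 * v 2) := by
  have h : LieAlgebra.ad ℝ so3 (hat u) ∘ₗ LieAlgebra.ad ℝ so3 (hat v) =
      hat.conj (crossProduct u ∘ₗ crossProduct v) := by
    ext1 x
    obtain ⟨w, rfl⟩ := hat.surjective x
    simp [LinearEquiv.conj_apply, bracket_hat]
  rw [g0, LinearMap.neg_apply, LinearMap.neg_apply, killingForm_apply_apply, h,
    LinearMap.trace_conj', LinearMap.trace_eq_matrix_trace ℝ (Pi.basisFun ℝ (Fin 3))]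
  simp [Matrix.trace, Fin.sum_univ_three, cross_apply, Pi.single_apply]
  ring

theorem Theta_eq (j : Fin 3) : Theta j = hat ((1 / √2 : ℝ) • Pi.single j 1) := by
  rw [map_smul, Theta]
  congr 1
  ext a b
  fin_cases j <;> fin_cases a <;> fin_cases b <;> simp [coe_hat, crossMatrix]

theorem Omega_hat (c v : Fin 3 → ℝ) : Omega c (hat v) = hat fun i => c i * v i := by
  -- The two factors 1/√2 from the basis vectors cancel the 2 in `g0_hat`.
  have h2 : (√2 : ℝ)⁻¹ * (√2)⁻¹ = 2⁻¹ := by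
    rw [← mul_inv, Real.mul_self_sqrt (by norm_num)]
  simp only [Omega, LinearMap.sum_apply, LinearMap.smul_apply, LinearMap.smulRight_apply,
    Theta_eq, g0_hat, ← map_smul, ← map_sum]
  congr 1
  ext i
  fin_cases i <;> simp [Pi.single_apply] <;> left <;>
    linear_combination (2 * v _) * h2

theorem gNat_hat (α A : ℝ) (u v : Fin 3 → ℝ) :
    gNat α A (hat u) (hat v) = 2 * (α * u 0 * v 0 + α * u 1 * v 1 + A * u 2 * v 2) := by
  rw [gNat, metric, LinearMap.comp_apply, Omega_hat, g0_hat]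
  simp

theorem mem_frakK {x : so3} : x ∈ frakK ↔ ∃ z : ℝ, x = hat ![0, 0, z] := by
  rw [frakK, Submodule.mem_span_singleton]
  simp only [Theta_eq, ← map_smul]
  constructor
  · rintro ⟨a, rfl⟩
    refine ⟨a * (1 / √2), congrArg hat ?_⟩
    ext i
    fin_cases i <;> simp
  · rintro ⟨z, rfl⟩
    refine ⟨z * √2, congrArg hat ?_⟩
    ext i
    fin_cases i <;> simp

theorem mem_frakM {x : so3} : x ∈ frakM ↔ ∃ a b : ℝ, x = hat ![a, b, 0] := by
  obtain ⟨v, rfl⟩ := hat.surjective x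
  rw [frakM, LinearMap.BilinForm.mem_orthogonal_iff]
  simp only [mem_frakK]
  constructor
  · intro h
    have := h _ ⟨1, rfl⟩
    rw [g0_hat] at this
    refine ⟨v 0, v 1, congrArg hat ?_⟩
    ext i
    fin_cases i <;> simp
    simpa using this
  · rintro ⟨a, b, h⟩ _ ⟨z, rfl⟩
    simp [h, g0_hat]

theorem mem_frakP1 {x : so3 × so3} : x ∈ frakP1 ↔ ∃ a b : ℝ, x = (hat ![a, b, 0], 0) := by
  rw [frakP1, Submodule.mem_prod, mem_frakM, Submodule.mem_bot]
  simp [Prod.ext_iff]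

theorem mem_frakQ0 {α A : ℝ} {x : so3 × so3} : x ∈ frakQ0 α A ↔
    ∃ z : ℝ, x = (hat ![0, 0, Abar α A * z], hat ![0, 0, -α * z]) := by
  rw [frakQ0, Submodule.mem_map]
  constructor
  · rintro ⟨y, hy, rfl⟩
    obtain ⟨z, rfl⟩ := mem_frakK.1 hy
    refine ⟨z, ?_⟩
    simp [← map_smul, ← map_neg]
  · rintro ⟨z, rfl⟩
    refine ⟨hat ![0, 0, z], mem_frakK.2 ⟨z, rfl⟩, ?_⟩
    simp [← map_smul, ← map_neg]

theorem mem_frakP {α A : ℝ} {x : so3 × so3} : x ∈ frakP α A ↔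
    ∃ a b z : ℝ, x = (hat ![a, b, Abar α A * z], hat ![0, 0, -α * z]) := by
  rw [frakP, Submodule.mem_sup]
  have h : ∀ a b z : ℝ, ((hat ![a, b, 0], 0) : so3 × so3) +
      (hat ![0, 0, Abar α A * z], hat ![0, 0, -α * z]) =
        (hat ![a, b, Abar α A * z], hat ![0, 0, -α * z]) := fun a b z => by
    simp [← map_add]
  constructor
  · rintro ⟨y, hy, w, hw, rfl⟩
    obtain ⟨a, b, rfl⟩ := mem_frakP1.1 hy
    obtain ⟨z, rfl⟩ := mem_frakQ0.1 hw
    exact ⟨a, b, z, h a b z⟩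
  · rintro ⟨a, b, z, rfl⟩
    exact ⟨_, mem_frakP1.2 ⟨a, b, rfl⟩, _, mem_frakQ0.2 ⟨z, rfl⟩, h a b z⟩

/-! ### Matrix-valued curves and the matrix exponential -/

section MatrixCurves

open scoped Matrix.Norms.Operator
open NormedSpace (exp)

/-- Smoothness and velocity are defined entrywise, while the exponential is differentiated in the
normed algebra of matrices; this is the bridge. -/
theorem hasDerivAt_matrix {M : ℝ → Matrix (Fin 3) (Fin 3) ℝ} {M' : Matrix (Fin 3) (Fin 3) ℝ}
    {t : ℝ} : HasDerivAt M M' t ↔ ∀ i j, HasDerivAt (fun s => M s i j) (M' i j) t := by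
  have h1 : HasDerivAt M M' t ↔ ∀ i, HasDerivAt (fun s => M s i) (M' i) t :=
    hasDerivAt_pi (φ := M) (φ' := M')
  rw [h1]
  exact forall_congr' fun i => hasDerivAt_pi

theorem hasDerivAt_exp_smul (K : Matrix (Fin 3) (Fin 3) ℝ) (t : ℝ) :
    HasDerivAt (fun s : ℝ => exp (s • K)) (exp (t • K) * K) t :=
  hasDerivAt_exp_smul_const K t

theorem hasDerivAt_exp_smul' (K : Matrix (Fin 3) (Fin 3) ℝ) (t : ℝ) :
    HasDerivAt (fun s : ℝ => exp (s • K)) (K * exp (t • K)) t :=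
  hasDerivAt_exp_smul_const' K t

theorem exp_smul_mul_exp_smul (K : Matrix (Fin 3) (Fin 3) ℝ) (s t : ℝ) :
    exp (s • K) * exp (t • K) = exp ((s + t) • K) := by
  rw [add_smul, Matrix.exp_add_of_commute]
  exact ((Commute.refl K).smul_left s).smul_right t

theorem exp_neg_smul_mul_exp_smul (K : Matrix (Fin 3) (Fin 3) ℝ) (t : ℝ) :
    exp ((-t) • K) * exp (t • K) = 1 := by
  rw [exp_smul_mul_exp_smul]
  simp

theorem exp_smul_mul_exp_neg_smul (K : Matrix (Fin 3) (Fin 3) ℝ) (t : ℝ) :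
    exp (t • K) * exp ((-t) • K) = 1 := by
  rw [exp_smul_mul_exp_smul]
  simp

theorem hasDerivAt_exp_neg_smul (K : Matrix (Fin 3) (Fin 3) ℝ) (t : ℝ) :
    HasDerivAt (fun s : ℝ => exp ((-s) • K)) (-(K * exp ((-t) • K))) t := by
  have h := hasDerivAt_exp_smul' (-K) t
  simpa only [smul_neg, neg_smul, neg_mul] using h

theorem matrix_eq_of_hasDerivAt_zero {M : ℝ → Matrix (Fin 3) (Fin 3) ℝ}
    (h : ∀ t, HasDerivAt M 0 t) (s t : ℝ) : M s = M t :=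
  is_const_of_deriv_eq_zero (fun t => (h t).differentiableAt) (fun t => (h t).deriv) s t

/-- Uniqueness for the linear equation `F' = F K`. -/
theorem eq_mul_exp_of_hasDerivAt {F : ℝ → Matrix (Fin 3) (Fin 3) ℝ}
    {K : Matrix (Fin 3) (Fin 3) ℝ} (h : ∀ t, HasDerivAt F (F t * K) t) (t : ℝ) :
    F t = F 0 * exp (t • K) := by
  have h1 : ∀ s, HasDerivAt (fun s => F s * exp ((-s) • K)) 0 s := fun s => by
    have := (h s).mul (hasDerivAt_exp_neg_smul K s)
    rwa [mul_neg, mul_assoc, add_neg_cancel] at this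
  have h2 := matrix_eq_of_hasDerivAt_zero h1 t 0
  simp only [neg_zero, zero_smul, NormedSpace.exp_zero, mul_one] at h2
  rw [← h2, mul_assoc, exp_neg_smul_mul_exp_smul, mul_one]

theorem contDiff_exp_smul (K : Matrix (Fin 3) (Fin 3) ℝ) :
    ContDiff ℝ ∞ fun t : ℝ => exp (t • K) := by
  have h : ContDiff ℝ ∞ (exp : Matrix (Fin 3) (Fin 3) ℝ → Matrix (Fin 3) (Fin 3) ℝ) := by
    rw [← contDiffOn_univ]
    exact AnalyticOn.contDiffOn (fun x _ => (NormedSpace.exp_analytic x).analyticWithinAt)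
      uniqueDiffOn_univ
  exact h.comp (contDiff_id.smul contDiff_const)

theorem contDiff_entry {M : ℝ → Matrix (Fin 3) (Fin 3) ℝ} (h : ContDiff ℝ ∞ M) (i j : Fin 3) :
    ContDiff ℝ ∞ fun t => M t i j :=
  (LinearMap.toContinuousLinearMap (Matrix.entryLinearMap ℝ ℝ i j)).contDiff.comp h

/-! ### Rodrigues' formula -/

theorem crossMatrix_cube (v : Fin 3 → ℝ) :
    crossMatrix v * crossMatrix v * crossMatrix v = -(v ⬝ᵥ v) • crossMatrix v := by
  ext a b
  fin_cases a <;> fin_cases b <;> simp [crossMatrix, Matrix.vec3_dotProduct] <;> ring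

/-- Because K³ = -r²K, the right-hand side F satisfies F' = F K and F(0) = 1, which characterises
the exponential. -/
theorem exp_crossMatrix (v : Fin 3 → ℝ) {r : ℝ} (hr : r ≠ 0) (hv : v ⬝ᵥ v = r ^ 2) (t : ℝ) :
    exp (t • crossMatrix v) = 1 + (Real.sin (t * r) / r) • crossMatrix v +
      ((1 - Real.cos (t * r)) / r ^ 2) • (crossMatrix v * crossMatrix v) := by
  set K := crossMatrix v with hK
  have hK3 : K * K * K = -(r ^ 2) • K := by rw [← hv, hK, crossMatrix_cube]
  let F : ℝ → Matrix (Fin 3) (Fin 3) ℝ := fun t => 1 + (Real.sin (t * r) / r) • K +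
      ((1 - Real.cos (t * r)) / r ^ 2) • (K * K)
  have hs : ∀ t : ℝ, HasDerivAt (fun s => Real.sin (s * r) / r) (Real.cos (t * r)) t := fun t => by
    have := (((hasDerivAt_id t).mul_const r).sin).div_const r
    simpa [hr] using this
  have hc : ∀ t : ℝ, HasDerivAt (fun s => (1 - Real.cos (s * r)) / r ^ 2)
      (Real.sin (t * r) / r) t := fun t => by
    have := ((((hasDerivAt_id t).mul_const r).cos).const_sub 1).div_const (r ^ 2)
    refine this.congr_deriv ?_
    simp only [id]
    field_simp
  have hF : ∀ t, HasDerivAt F (F t * K) t := fun t => by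
    have h := (((hs t).smul_const K).const_add 1).add ((hc t).smul_const (K * K))
    refine h.congr_deriv ?_
    simp only [F, add_mul, one_mul, smul_mul_assoc, hK3, smul_smul]
    have : (1 - Real.cos (t * r)) / r ^ 2 * -r ^ 2 = Real.cos (t * r) - 1 := by
      field_simp
      ring
    rw [this, sub_smul, one_smul]
    abel
  have h0 : F 0 = 1 := by simp [F]
  have := eq_mul_exp_of_hasDerivAt hF t
  rw [h0, one_mul] at this
  exact this.symm

end MatrixCurves

/-! ### The exponential map of `SO(3)` -/

theorem coe_expSO3 (X : so3) : (expSO3 X : Matrix (Fin 3) (Fin 3) ℝ) =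
    NormedSpace.exp (X : Matrix (Fin 3) (Fin 3) ℝ) := rfl

theorem expSO3_zero : expSO3 0 = 1 := Subtype.ext (by simp [coe_expSO3])

theorem expSO3_smul_mul (X : so3) (s t : ℝ) :
    expSO3 (s • X) * expSO3 (t • X) = expSO3 ((s + t) • X) :=
  Subtype.ext (exp_smul_mul_exp_smul X s t)

theorem expSO3_neg_mul (X : so3) : expSO3 (-X) * expSO3 X = 1 := by
  have := expSO3_smul_mul X (-1) 1
  simpa [expSO3_zero] using this

theorem expSO3_neg (X : so3) : expSO3 (-X) = (expSO3 X)⁻¹ :=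
  eq_inv_of_mul_eq_one_left (expSO3_neg_mul X)

theorem exp_mulVec_self (v : Fin 3 → ℝ) (t : ℝ) :
    NormedSpace.exp (t • crossMatrix v) *ᵥ v = v := by
  have hv : crossMatrix v *ᵥ v = 0 := by
    ext i
    fin_cases i <;> simp [crossMatrix, Matrix.mulVec, dotProduct, Fin.sum_univ_three] <;> ring
  rcases eq_or_ne (v ⬝ᵥ v) 0 with h | h
  · simp [dotProduct_self_eq_zero.1 h]
  · have h0 : 0 ≤ v ⬝ᵥ v := Finset.sum_nonneg fun i _ => mul_self_nonneg (v i)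
    rw [exp_crossMatrix v (Real.sqrt_ne_zero'.2 (lt_of_le_of_ne h0 h.symm)) (Real.sq_sqrt h0).symm]
    simp [Matrix.add_mulVec, Matrix.smul_mulVec, ← Matrix.mulVec_mulVec, hv]

theorem crossMatrix_sq (v : Fin 3 → ℝ) : crossMatrix v * crossMatrix v =
    Matrix.vecMulVec v v - (v ⬝ᵥ v) • 1 := by
  ext a b
  fin_cases a <;> fin_cases b <;>
    simp [crossMatrix, Matrix.vec3_dotProduct, Matrix.vecMulVec_apply] <;> ring

/-- In Rodrigues' formula K has trace 0 and K² has trace -2r², so the trace alone detects cos(tr) =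
1; conversely cos(tr) = 1 forces sin(tr) = 0. -/
theorem exp_eq_one_iff (v : Fin 3 → ℝ) {r : ℝ} (hr : r ≠ 0) (hv : v ⬝ᵥ v = r ^ 2) (t : ℝ) :
    expSO3 (t • hat v) = 1 ↔ ∃ n : ℤ, (n : ℝ) * (2 * Real.pi) = t * r := by
  rw [← Real.cos_eq_one_iff, Subtype.ext_iff]
  change NormedSpace.exp (t • crossMatrix v) = 1 ↔ _
  rw [exp_crossMatrix v hr hv]
  constructor
  · intro h
    have h1 := congrArg Matrix.trace h
    have hv' := hv
    rw [Matrix.vec3_dotProduct] at hv'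
    simp only [Matrix.trace_add, Matrix.trace_smul, crossMatrix_sq, Matrix.trace_sub, hv] at h1
    simp [Matrix.trace, Fin.sum_univ_three, crossMatrix, Matrix.vecMulVec_apply, hv'] at h1
    rcases h1 with h1 | h1
    · rcases h1 with h1 | h1
      · exact (sub_eq_zero.1 h1).symm
      · exact absurd h1 hr
    · exact absurd (by linarith : r ^ 2 = 0) (pow_ne_zero 2 hr)
  · intro h
    have hs : Real.sin (t * r) = 0 := by
      have := Real.sin_sq_add_cos_sq (t * r)
      rw [h] at this
      simpa using this
    simp [h, hs]

/-- Rotations about different axes are different unless both are trivial. -/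
theorem exp_eq_one_of_exp_eq {a b c d r : ℝ} (hr : r ≠ 0) (hv : ![a, b, c] ⬝ᵥ ![a, b, c] = r ^ 2)
    (hab : a ^ 2 + b ^ 2 ≠ 0) (hd : d ≠ 0) {t : ℝ}
    (h : expSO3 (t • hat ![a, b, c]) = expSO3 (t • hat ![0, 0, d])) :
    expSO3 (t • hat ![a, b, c]) = 1 := by
  -- The second rotation fixes its own axis, hence so does the first. The third coordinate of
  -- Rodrigues' formula then gives (1 - cos(tr))(a² + b²) = 0.
  have h1 : NormedSpace.exp (t • crossMatrix ![a, b, c]) *ᵥ ![0, 0, d] = ![0, 0, d] := by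
    have := congrArg Subtype.val h
    change NormedSpace.exp (t • crossMatrix ![a, b, c]) =
      NormedSpace.exp (t • crossMatrix ![0, 0, d]) at this
    rw [this, exp_mulVec_self]
  rw [exp_eq_one_iff _ hr hv, ← Real.cos_eq_one_iff]
  rw [exp_crossMatrix _ hr hv] at h1
  have h2 := congrFun h1 2
  rw [crossMatrix_sq, hv] at h2
  rw [Matrix.vec3_dotProduct] at hv
  simp at hv
  simp [Matrix.mulVec, dotProduct, Fin.sum_univ_three, crossMatrix] at h2
  have h3 : (1 - Real.cos (t * r)) * (a ^ 2 + b ^ 2) = 0 := by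
    field_simp at h2
    linear_combination -h2 + (1 - Real.cos (t * r)) * hv
  rcases mul_eq_zero.1 h3 with h | h
  · linarith
  · exact absurd h hab

/-! ### Smooth curves in `SO(3)` and their left velocity -/

section Curves

open scoped Matrix.Norms.Operator

theorem transpose_mul_self (u : SO3) :
    (u : Matrix (Fin 3) (Fin 3) ℝ)ᵀ * (u : Matrix (Fin 3) (Fin 3) ℝ) = 1 :=
  (Matrix.mem_orthogonalGroup_iff' (Fin 3) ℝ).1 (Matrix.mem_specialOrthogonalGroup_iff.1 u.2).1

theorem mul_transpose_self (u : SO3) :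
    (u : Matrix (Fin 3) (Fin 3) ℝ) * (u : Matrix (Fin 3) (Fin 3) ℝ)ᵀ = 1 :=
  (Matrix.mem_orthogonalGroup_iff (Fin 3) ℝ).1 (Matrix.mem_specialOrthogonalGroup_iff.1 u.2).1

theorem coe_leftVelocity {γ : ℝ → SO3} (hγ : SmoothCurve γ) (t : ℝ) :
    (leftVelocity γ t : Matrix (Fin 3) (Fin 3) ℝ) =
      (γ t : Matrix (Fin 3) (Fin 3) ℝ)ᵀ * velocity γ t := by
  rw [leftVelocity, dif_pos (transpose_mul_velocity_mem γ hγ t)]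

theorem hasDerivAt_velocity {γ : ℝ → SO3} (hγ : SmoothCurve γ) (t : ℝ) :
    HasDerivAt (fun s => (γ s : Matrix (Fin 3) (Fin 3) ℝ)) (velocity γ t) t :=
  hasDerivAt_matrix.2 fun i j => (((hγ i j).differentiable (by simp)) t).hasDerivAt

theorem hasDerivAt_curve {γ : ℝ → SO3} (hγ : SmoothCurve γ) (t : ℝ) :
    HasDerivAt (fun s => (γ s : Matrix (Fin 3) (Fin 3) ℝ))
      ((γ t : Matrix (Fin 3) (Fin 3) ℝ) * (leftVelocity γ t : Matrix (Fin 3) (Fin 3) ℝ)) t := by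
  rw [coe_leftVelocity hγ, ← mul_assoc, mul_transpose_self, one_mul]
  exact hasDerivAt_velocity hγ t

theorem leftVelocity_eq {γ : ℝ → SO3} (hγ : SmoothCurve γ) {t : ℝ} {X : so3}
    (h : HasDerivAt (fun s => (γ s : Matrix (Fin 3) (Fin 3) ℝ))
      ((γ t : Matrix (Fin 3) (Fin 3) ℝ) * (X : Matrix (Fin 3) (Fin 3) ℝ)) t) :
    leftVelocity γ t = X := by
  apply Subtype.ext
  rw [coe_leftVelocity hγ, (hasDerivAt_velocity hγ t).unique h, ← mul_assoc, transpose_mul_self,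
    one_mul]

theorem smoothCurve_of_contDiff {γ : ℝ → SO3}
    (h : ContDiff ℝ ∞ fun t => (γ t : Matrix (Fin 3) (Fin 3) ℝ)) : SmoothCurve γ :=
  fun i j => contDiff_entry h i j

theorem contDiff_leftVelocity {γ : ℝ → SO3} (hγ : SmoothCurve γ) (i j : Fin 3) :
    ContDiff ℝ ∞ fun t => (leftVelocity γ t : Matrix (Fin 3) (Fin 3) ℝ) i j := by
  simp only [coe_leftVelocity hγ, Matrix.mul_apply, Matrix.transpose_apply]
  exact ContDiff.sum fun k _ => (hγ k i).mul (contDiff_infty_iff_deriv.1 (hγ k j)).2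

/-- The coordinates of the left velocity. -/
def bodyVelocity (γ : ℝ → SO3) (t : ℝ) : Fin 3 → ℝ := hat.symm (leftVelocity γ t)

theorem hat_bodyVelocity (γ : ℝ → SO3) (t : ℝ) : hat (bodyVelocity γ t) = leftVelocity γ t :=
  hat.apply_symm_apply _

theorem contDiff_bodyVelocity {γ : ℝ → SO3} (hγ : SmoothCurve γ) (i : Fin 3) :
    ContDiff ℝ ∞ fun t => bodyVelocity γ t i := by
  simp only [bodyVelocity, hat_symm_apply]
  fin_cases i <;> exact contDiff_leftVelocity hγ _ _

theorem smoothCurve_mul_left (u : SO3) {γ : ℝ → SO3} (hγ : SmoothCurve γ) :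
    SmoothCurve fun t => u * γ t := fun i j => by
  simp only [Submonoid.coe_mul, Matrix.mul_apply]
  exact ContDiff.sum fun k _ => contDiff_const.mul (hγ k j)

theorem leftVelocity_mul_left (u : SO3) {γ : ℝ → SO3} (hγ : SmoothCurve γ) (t : ℝ) :
    leftVelocity (fun t => u * γ t) t = leftVelocity γ t := by
  apply leftVelocity_eq (smoothCurve_mul_left u hγ)
  have := (hasDerivAt_curve hγ t).const_mul (u : Matrix (Fin 3) (Fin 3) ℝ)
  rwa [← mul_assoc] at this

theorem smoothCurve_gammaVW (VW : so3 × so3) : SmoothCurve (gammaVW VW) := by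
  apply smoothCurve_of_contDiff
  have h := (contDiff_exp_smul (VW.1 : Matrix (Fin 3) (Fin 3) ℝ)).mul
    (contDiff_exp_smul (-(VW.2 : Matrix (Fin 3) (Fin 3) ℝ)))
  simp only [smul_neg] at h
  exact h

end Curves

/-! ### The Levi-Civita connection and the geodesic equation -/

/-- The right-hand side of Euler's equation `v' = eulerField α A v` for the metric `g_{(α,α,A)}`. -/
def eulerField (α A : ℝ) (v : Fin 3 → ℝ) : Fin 3 → ℝ :=
  ![(α - A) / α * (v 1 * v 2), -((α - A) / α * (v 0 * v 2)), 0]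

theorem gNat_self_left_inj {α A : ℝ} (hα : 0 < α) (hA : 0 < A) {x y : so3}
    (h : ∀ z, gNat α A x z = gNat α A y z) : x = y := by
  obtain ⟨u, rfl⟩ := hat.surjective x
  obtain ⟨v, rfl⟩ := hat.surjective y
  refine congrArg hat (funext fun i => ?_)
  have := h (hat (Pi.single i 1))
  rw [gNat_hat, gNat_hat] at this
  fin_cases i <;> simpa [hα.ne', hA.ne'] using this

/-- Koszul's argument on the diagonal: metricity and vanishing torsion give g(Γ(v,v), w) = -g(v,
[v,w]). The geodesic equation sees only this diagonal, so it does not depend on which Γ is chosen.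
-/
theorem IsLeviCivita.apply_self {α A : ℝ} (hα : 0 < α) (hA : 0 < A)
    {Γ : SO3 → so3 →ₗ[ℝ] so3 →ₗ[ℝ] so3} (h : IsLeviCivita (gNat α A) Γ) (u : SO3)
    (v : Fin 3 → ℝ) : Γ u (hat v) (hat v) = -hat (eulerField α A v) := by
  apply gNat_self_left_inj hα hA
  intro z
  obtain ⟨w, rfl⟩ := hat.surjective z
  have hsymm : ∀ x y, gNat α A x y = gNat α A y x := fun x y => by
    obtain ⟨a, rfl⟩ := hat.surjective x
    obtain ⟨b, rfl⟩ := hat.surjective y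
    rw [gNat_hat, gNat_hat]
    ring
  have h1 := h.metric_compatible u (hat v) (hat v) (hat w)
  have h2 := h.metric_compatible u (hat w) (hat v) (hat v)
  have h3 := h.torsion_free u (hat v) (hat w)
  rw [hsymm (Γ u (hat w) (hat v))] at h2
  rw [sub_eq_iff_eq_add.1 h3, map_add, bracket_hat, gNat_hat] at h1
  rw [← map_neg, gNat_hat]
  simp [cross_apply, eulerField] at h1 ⊢
  field_simp
  linarith

/-- The coefficients of the Levi-Civita connection of `g_{(α,α,A)}`. -/
def leviCivita (α A : ℝ) : so3 →ₗ[ℝ] so3 →ₗ[ℝ] so3 :=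
  LinearMap.mk₂ ℝ (fun x y => hat
    ![A / (2 * α) * (hat.symm x 1 * hat.symm y 2) +
        (A / (2 * α) - 1) * (hat.symm x 2 * hat.symm y 1),
      -(A / (2 * α) * (hat.symm x 0 * hat.symm y 2)) -
        (A / (2 * α) - 1) * (hat.symm x 2 * hat.symm y 0),
      (hat.symm x 0 * hat.symm y 1 - hat.symm x 1 * hat.symm y 0) / 2])
    (fun x y z => by rw [← map_add]; congr 1; ext i; fin_cases i <;> simp <;> ring)
    (fun r x y => by rw [← map_smul]; congr 1; ext i; fin_cases i <;> simp <;> ring)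
    (fun x y z => by rw [← map_add]; congr 1; ext i; fin_cases i <;> simp <;> ring)
    (fun r x y => by rw [← map_smul]; congr 1; ext i; fin_cases i <;> simp <;> ring)

theorem leviCivita_hat (α A : ℝ) (x y : Fin 3 → ℝ) : leviCivita α A (hat x) (hat y) = hat
    ![A / (2 * α) * (x 1 * y 2) + (A / (2 * α) - 1) * (x 2 * y 1),
      -(A / (2 * α) * (x 0 * y 2)) - (A / (2 * α) - 1) * (x 2 * y 0),
      (x 0 * y 1 - x 1 * y 0) / 2] := by
  simp only [leviCivita, LinearMap.mk₂_apply, LinearEquiv.symm_apply_apply]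

theorem isLeviCivita_leviCivita {α : ℝ} (hα : 0 < α) (A : ℝ) :
    IsLeviCivita (gNat α A) fun _ => leviCivita α A where
  torsion_free u x y := by
    obtain ⟨x, rfl⟩ := hat.surjective x
    obtain ⟨y, rfl⟩ := hat.surjective y
    rw [leviCivita_hat, leviCivita_hat, bracket_hat, ← map_sub]
    congr 1
    ext i
    fin_cases i <;> simp [cross_apply] <;> ring
  metric_compatible u x y z := by
    obtain ⟨x, rfl⟩ := hat.surjective x
    obtain ⟨y, rfl⟩ := hat.surjective y
    obtain ⟨z, rfl⟩ := hat.surjective z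
    rw [leviCivita_hat, leviCivita_hat, gNat_hat, gNat_hat]
    simp
    field_simp
    ring

theorem hasDerivAt_crossMatrix {w : ℝ → Fin 3 → ℝ} {w' : Fin 3 → ℝ} {t : ℝ}
    (h : ∀ i, HasDerivAt (fun s => w s i) (w' i) t) (i j : Fin 3) :
    HasDerivAt (fun s => crossMatrix (w s) i j) (crossMatrix w' i j) t := by
  fin_cases i <;> fin_cases j <;> simp [crossMatrix] <;>
    first
      | exact hasDerivAt_const _ _
      | exact h _
      | exact (h _).neg

theorem covDeriv_leftVelocity {α A : ℝ} (hα : 0 < α) (hA : 0 < A)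
    {Γ : SO3 → so3 →ₗ[ℝ] so3 →ₗ[ℝ] so3} (h : IsLeviCivita (gNat α A) Γ) {γ : ℝ → SO3} {t : ℝ}
    {w' : Fin 3 → ℝ} (hw : ∀ i, HasDerivAt (fun s => bodyVelocity γ s i) (w' i) t) :
    covDeriv Γ γ (leftVelocity γ) t =
      (hat (w' - eulerField α A (bodyVelocity γ t)) : so3) := by
  have h1 : Matrix.of (fun i j =>
      deriv (fun s => (leftVelocity γ s : Matrix (Fin 3) (Fin 3) ℝ) i j) t) = crossMatrix w' := by
    ext i j
    simp only [← hat_bodyVelocity, coe_hat]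
    exact (hasDerivAt_crossMatrix hw i j).deriv
  rw [covDeriv, h1, ← hat_bodyVelocity, h.apply_self hα hA, map_sub, sub_eq_add_neg]
  rfl

/-- Geodesics of `g_{(α,α,A)}` are the smooth curves whose left velocity solves Euler's
equation. -/
theorem isGeodesic_iff {α A : ℝ} (hα : 0 < α) (hA : 0 < A) {γ : ℝ → SO3} :
    IsGeodesic (gNat α A) γ ↔ SmoothCurve γ ∧ ∀ t i,
      HasDerivAt (fun s => bodyVelocity γ s i) (eulerField α A (bodyVelocity γ t) i) t := by
  constructor
  · rintro ⟨hγ, Γ, hΓ, h⟩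
    refine ⟨hγ, fun t => ?_⟩
    have hd : ∀ i, HasDerivAt (fun s => bodyVelocity γ s i)
        (deriv (fun s => bodyVelocity γ s i) t) t := fun i =>
      (((contDiff_bodyVelocity hγ i).differentiable (by simp)) t).hasDerivAt
    have h1 := h t
    rw [covDeriv_leftVelocity (w' := fun i => deriv (fun s => bodyVelocity γ s i) t) hα hA hΓ hd]
      at h1
    have h2 : (fun i => deriv (fun s => bodyVelocity γ s i) t) -
        eulerField α A (bodyVelocity γ t) = 0 :=
      (LinearEquiv.map_eq_zero_iff hat).1 (Subtype.ext h1)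
    rw [← sub_eq_zero.1 h2]
    exact hd
  · rintro ⟨hγ, h⟩
    -- The definition of a geodesic asks for some Levi-Civita connection, so an explicit one has to
    -- be exhibited.
    refine ⟨hγ, _, isLeviCivita_leviCivita hα A, fun t => ?_⟩
    rw [covDeriv_leftVelocity hα hA (isLeviCivita_leviCivita hα A) (h t), sub_self, map_zero]
    rfl

theorem IsGeodesic.mul_left {α A : ℝ} (hα : 0 < α) (hA : 0 < A) (u : SO3) {γ : ℝ → SO3}
    (h : IsGeodesic (gNat α A) γ) : IsGeodesic (gNat α A) fun t => u * γ t := by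
  rw [isGeodesic_iff hα hA] at h ⊢
  refine ⟨smoothCurve_mul_left u h.1, ?_⟩
  simp only [bodyVelocity, leftVelocity_mul_left u h.1]
  exact h.2

/-! ### Explicit form of the geodesics -/

section Solution

open scoped Matrix.Norms.Operator
open NormedSpace (exp)

/-- The derivative of the left side vanishes: the commutator coming from w' = W × w cancels the
terms from the two exponentials. In the frame rotating with W, the vector w is at rest. -/
theorem exp_conj_crossMatrix {W : Fin 3 → ℝ} {w : ℝ → Fin 3 → ℝ}
    (h : ∀ t i, HasDerivAt (fun s => w s i) ((W ⨯₃ w t) i) t) (t : ℝ) :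
    exp ((-t) • crossMatrix W) * crossMatrix (w t) * exp (t • crossMatrix W) =
      crossMatrix (w 0) := by
  have h1 : ∀ t, HasDerivAt (fun s => exp ((-s) • crossMatrix W) * crossMatrix (w s) *
      exp (s • crossMatrix W)) 0 t := fun t => by
    have hM : HasDerivAt (fun s => crossMatrix (w s)) (crossMatrix (W ⨯₃ w t)) t :=
      hasDerivAt_matrix.2 fun i j => hasDerivAt_crossMatrix (h t) i j
    have hE : HasDerivAt (fun s : ℝ => exp ((-s) • crossMatrix W))
        (-(exp ((-t) • crossMatrix W) * crossMatrix W)) t := by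
      have := hasDerivAt_exp_smul (-crossMatrix W) t
      simpa only [smul_neg, neg_smul, mul_neg] using this
    refine ((hE.mul hM).mul (hasDerivAt_exp_smul' (crossMatrix W) t)).congr_deriv ?_
    rw [← crossMatrix_mul_sub, Pi.mul_apply]
    noncomm_ring
  have h2 := matrix_eq_of_hasDerivAt_zero h1 t 0
  simpa using h2

/-- The pair `(V, W)` for which `exp(tV) exp(-tW)` is the geodesic of `g_{(α,α,A)}` through the
identity with initial velocity `v`. -/
def geodesicPair (α A : ℝ) (v : Fin 3 → ℝ) : so3 × so3 :=
  (hat ![v 0, v 1, A / α * v 2], hat ![0, 0, -((α - A) / α * v 2)])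

theorem geodesicPair_fst {α : ℝ} (hα : 0 < α) (A : ℝ) (v : Fin 3 → ℝ) :
    ![v 0, v 1, A / α * v 2] = v + ![0, 0, -((α - A) / α * v 2)] := by
  ext i
  fin_cases i <;> simp
  field_simp
  ring

theorem eulerField_eq_cross (α A : ℝ) (v : Fin 3 → ℝ) :
    eulerField α A v = ![0, 0, -((α - A) / α * v 2)] ⨯₃ v := by
  ext i
  fin_cases i <;> simp [eulerField, cross_apply] <;> ring

theorem coe_gammaVW (V W : so3) (t : ℝ) :
    (gammaVW (V, W) t : Matrix (Fin 3) (Fin 3) ℝ) =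
      exp (t • (V : Matrix (Fin 3) (Fin 3) ℝ)) * exp ((-t) • (W : Matrix (Fin 3) (Fin 3) ℝ)) := by
  rw [neg_smul]
  rfl

theorem gammaVW_zero (VW : so3 × so3) : gammaVW VW 0 = 1 := by
  simp [gammaVW, expSO3_zero]

/-- The derivative is exp(tV)(V - W)exp(-tW) with V - W = w(0), and `exp_conj_crossMatrix` moves
w(0) to the right past exp(-tW), where it becomes w(t). -/
theorem leftVelocity_gammaVW (V : so3) {W : Fin 3 → ℝ} {w : ℝ → Fin 3 → ℝ}
    (hV : V = hat (w 0 + W))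
    (h : ∀ t i, HasDerivAt (fun s => w s i) ((W ⨯₃ w t) i) t) (t : ℝ) :
    leftVelocity (gammaVW (V, hat W)) t = hat (w t) := by
  apply leftVelocity_eq (smoothCurve_gammaVW _)
  have h1 := (hasDerivAt_exp_smul (V : Matrix (Fin 3) (Fin 3) ℝ) t).mul
    (hasDerivAt_exp_neg_smul (crossMatrix W) t)
  simp only [coe_gammaVW, coe_hat]
  refine h1.congr_deriv ?_
  have h2 := exp_conj_crossMatrix h t
  have h3 : exp ((-t) • crossMatrix W) * crossMatrix (w t) =
      crossMatrix (w 0) * exp ((-t) • crossMatrix W) := by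
    rw [← h2, mul_assoc _ (exp (t • crossMatrix W)), exp_smul_mul_exp_neg_smul, mul_one]
  rw [mul_assoc (exp _) (exp _) (crossMatrix (w t)), h3, hV, coe_hat, crossMatrix_add]
  noncomm_ring

theorem isGeodesic_gammaVW {α A : ℝ} (hα : 0 < α) (hA : 0 < A) (v : Fin 3 → ℝ) :
    IsGeodesic (gNat α A) (gammaVW (geodesicPair α A v)) ∧
      leftVelocity (gammaVW (geodesicPair α A v)) 0 = hat v := by
  set c := (α - A) / α * v 2 with hc
  -- The solution of Euler's equation from v: rotation about the third axis with angular velocity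
  -- -c.
  let w : ℝ → Fin 3 → ℝ := fun t => ![Real.cos (t * c) * v 0 + Real.sin (t * c) * v 1,
    -(Real.sin (t * c) * v 0) + Real.cos (t * c) * v 1, v 2]
  have hw0 : w 0 = v := by
    ext i
    fin_cases i <;> simp [w]
  have hcos : ∀ t : ℝ, HasDerivAt (fun s => Real.cos (s * c)) (-Real.sin (t * c) * c) t :=
    fun t => by simpa using ((hasDerivAt_id t).mul_const c).cos
  have hsin : ∀ t : ℝ, HasDerivAt (fun s => Real.sin (s * c)) (Real.cos (t * c) * c) t :=
    fun t => by simpa using ((hasDerivAt_id t).mul_const c).sin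
  have hw : ∀ t i, HasDerivAt (fun s => w s i) ((![0, 0, -c] ⨯₃ w t) i) t := fun t i => by
    fin_cases i
    · refine (((hcos t).mul_const (v 0)).add ((hsin t).mul_const (v 1))).congr_deriv ?_
      simp [w, cross_apply]
      ring
    · refine (((hsin t).mul_const (v 0)).neg.add ((hcos t).mul_const (v 1))).congr_deriv ?_
      simp [w, cross_apply]
      ring
    · refine (hasDerivAt_const t (v 2)).congr_deriv ?_
      simp [cross_apply]
  have hl := leftVelocity_gammaVW (hat ![v 0, v 1, A / α * v 2])
    (by rw [geodesicPair_fst hα, hw0]) hw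
  refine ⟨(isGeodesic_iff hα hA).2 ⟨smoothCurve_gammaVW _, fun t i => ?_⟩, ?_⟩
  · have hb : bodyVelocity (gammaVW (geodesicPair α A v)) = w := funext fun s => by
      rw [bodyVelocity, geodesicPair, hl, LinearEquiv.symm_apply_apply]
    rw [hb, eulerField_eq_cross]
    exact hw t i
  · rw [geodesicPair, hl, hw0]

theorem IsGeodesic.bodyVelocity_two {α A : ℝ} (hα : 0 < α) (hA : 0 < A) {γ : ℝ → SO3}
    (h : IsGeodesic (gNat α A) γ) (t : ℝ) : bodyVelocity γ t 2 = bodyVelocity γ 0 2 := by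
  have hd := ((isGeodesic_iff hα hA).1 h).2
  exact is_const_of_deriv_eq_zero (fun t => (hd t 2).differentiableAt)
    (fun t => (hd t 2).deriv.trans (by simp [eulerField])) t 0

theorem IsGeodesic.eq_gammaVW {α A : ℝ} (hα : 0 < α) (hA : 0 < A) {γ : ℝ → SO3}
    (h : IsGeodesic (gNat α A) γ) (h0 : γ 0 = 1) :
    γ = gammaVW (geodesicPair α A (bodyVelocity γ 0)) := by
  obtain ⟨hγ, hd⟩ := (isGeodesic_iff hα hA).1 h
  set v := bodyVelocity γ 0 with hv
  set W : Fin 3 → ℝ := ![0, 0, -((α - A) / α * v 2)] with hW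
  have hw : ∀ t i, HasDerivAt (fun s => bodyVelocity γ s i) ((W ⨯₃ bodyVelocity γ t) i) t :=
    fun t i => by
      have := hd t i
      rwa [eulerField_eq_cross, h.bodyVelocity_two hα hA t] at this
  -- Multiplying by exp(sW) makes the coefficient constant: it is W plus the conjugated left
  -- velocity, which stays equal to v. Linear uniqueness then replaces any nonlinear ODE theorem.
  have hP : ∀ t, HasDerivAt (fun s => (γ s : Matrix (Fin 3) (Fin 3) ℝ) * exp (s • crossMatrix W))
      ((γ t : Matrix (Fin 3) (Fin 3) ℝ) * exp (t • crossMatrix W) * crossMatrix (v + W)) t :=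
    fun t => by
      refine ((hasDerivAt_curve hγ t).mul (hasDerivAt_exp_smul (crossMatrix W) t)).congr_deriv ?_
      have h1 := exp_conj_crossMatrix hw t
      rw [← hat_bodyVelocity, coe_hat, crossMatrix_add, hv, ← h1, mul_add, mul_assoc (exp _),
        mul_assoc _ (exp _) (exp _ * _), ← mul_assoc (exp (t • _)) (exp (-t • _)),
        exp_smul_mul_exp_neg_smul]
      noncomm_ring
  funext t
  apply Subtype.ext
  have h2 := eq_mul_exp_of_hasDerivAt hP t
  rw [h0, zero_smul, NormedSpace.exp_zero, Submonoid.coe_one, mul_one, one_mul] at h2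
  rw [geodesicPair, coe_gammaVW, coe_hat, coe_hat, geodesicPair_fst hα, ← hW, ← h2, mul_assoc,
    exp_smul_mul_exp_neg_smul, mul_one]

end Solution

/-! ### Lengths and periods -/

theorem IsGeodesic.speed {α A : ℝ} (hα : 0 < α) (hA : 0 < A) {γ : ℝ → SO3}
    (h : IsGeodesic (gNat α A) γ) (t : ℝ) :
    gNat α A (leftVelocity γ t) (leftVelocity γ t) =
      gNat α A (leftVelocity γ 0) (leftVelocity γ 0) := by
  have hd := ((isGeodesic_iff hα hA).1 h).2
  have h1 : ∀ t, HasDerivAt (fun s => bodyVelocity γ s 0 * bodyVelocity γ s 0 +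
      bodyVelocity γ s 1 * bodyVelocity γ s 1) 0 t := fun t => by
    refine (((hd t 0).mul (hd t 0)).add ((hd t 1).mul (hd t 1))).congr_deriv ?_
    simp [eulerField]
    ring
  have h2 := is_const_of_deriv_eq_zero (fun t => (h1 t).differentiableAt)
    (fun t => (h1 t).deriv) t 0
  simp only [← hat_bodyVelocity, gNat_hat, h.bodyVelocity_two hα hA t]
  linear_combination (2 * α) * h2

theorem IsGeodesic.arcLength_eq {α A : ℝ} (hα : 0 < α) (hA : 0 < A) {γ : ℝ → SO3}
    (h : IsGeodesic (gNat α A) γ) (T : ℝ) :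
    arcLength (gNat α A) γ 0 T =
      T * √(gNat α A (leftVelocity γ 0) (leftVelocity γ 0)) := by
  simp only [arcLength, h.speed hα hA]
  simp

/-- Division with remainder: a nonzero remainder of T modulo T₀ would be a positive period below T₀.
-/
theorem exists_nat_mul_of_periodic {X : Type*} {γ : ℝ → X} {T₀ T : ℝ}
    (h₀ : IsLeast {S : ℝ | 0 < S ∧ Function.Periodic γ S} T₀) (hT : 0 < T)
    (h : Function.Periodic γ T) : ∃ k : ℕ, T = k * T₀ := by
  obtain ⟨⟨hpos, hper⟩, hmin⟩ := h₀
  have hfl := Nat.floor_le (div_pos hT hpos).le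
  have hlt := Nat.lt_floor_add_one (T / T₀)
  rw [le_div_iff₀ hpos] at hfl
  rw [div_lt_iff₀ hpos] at hlt
  refine ⟨⌊T / T₀⌋₊, ?_⟩
  by_contra hne
  have h1 : T₀ ≤ T - ⌊T / T₀⌋₊ * T₀ :=
    hmin ⟨sub_pos.2 (lt_of_le_of_ne hfl (Ne.symm hne)), h.sub_period (hper.nat_mul _)⟩
  linarith

theorem HasPrimitiveLength.exists_nat_mul {α A : ℝ} (hα : 0 < α) (hA : 0 < A) {γ : ℝ → SO3}
    (h : IsGeodesic (gNat α A) γ) {L T : ℝ} (hL : HasPrimitiveLength (gNat α A) γ L)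
    (hT : 0 < T) (hper : Function.Periodic γ T) :
    ∃ k : ℕ, arcLength (gNat α A) γ 0 T = k * L := by
  obtain ⟨T₀, h₀, rfl⟩ := hL
  obtain ⟨k, rfl⟩ := exists_nat_mul_of_periodic h₀ hT hper
  refine ⟨k, ?_⟩
  rw [h.arcLength_eq hα hA, h.arcLength_eq hα hA, mul_assoc]

theorem HasPrimitiveLength.isClosedGeodesic {g : LinearMap.BilinForm ℝ so3} {γ : ℝ → SO3}
    (h : IsGeodesic g γ) {L : ℝ} (hL : HasPrimitiveLength g γ L) : IsClosedGeodesic g γ := by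
  obtain ⟨T, ⟨hT, -⟩, -⟩ := hL
  exact ⟨h, T, hT⟩

theorem periodic_mul_left_iff (u : SO3) {γ : ℝ → SO3} {T : ℝ} :
    Function.Periodic (fun t => u * γ t) T ↔ Function.Periodic γ T :=
  forall_congr' fun _ => mul_right_inj u

theorem arcLength_mul_left (g : LinearMap.BilinForm ℝ so3) (u : SO3) {γ : ℝ → SO3}
    (hγ : SmoothCurve γ) (a b : ℝ) :
    arcLength g (fun t => u * γ t) a b = arcLength g γ a b := by
  simp only [arcLength, leftVelocity_mul_left u hγ]

theorem hasPrimitiveLength_mul_left_iff (g : LinearMap.BilinForm ℝ so3) (u : SO3) {γ : ℝ → SO3}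
    (hγ : SmoothCurve γ) {L : ℝ} :
    HasPrimitiveLength g (fun t => u * γ t) L ↔ HasPrimitiveLength g γ L := by
  simp only [HasPrimitiveLength, periodic_mul_left_iff, arcLength_mul_left g u hγ]

theorem periodic_gammaVW_iff (V W : so3) (T : ℝ) :
    Function.Periodic (gammaVW (V, W)) T ↔ expSO3 (T • V) = expSO3 (T • W) := by
  have h1 : gammaVW (V, W) T = 1 ↔ expSO3 (T • V) = expSO3 (T • W) := by
    rw [gammaVW, expSO3_neg, mul_inv_eq_one]
  rw [← h1]
  constructor
  · intro h
    rw [← gammaVW_zero (V, W), ← h 0, zero_add]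
  · intro h t
    have hV := expSO3_smul_mul V t T
    have hW := expSO3_smul_mul (-W) T t
    simp only [smul_neg] at hW
    rw [gammaVW] at h ⊢
    rw [← hV, add_comm t T, ← hW, mul_assoc, ← mul_assoc (expSO3 (T • _)), h, one_mul]
    rfl

/-! ### One-parameter subgroups -/

theorem gammaVW_zero_right (V : so3) (t : ℝ) : gammaVW (V, 0) t = expSO3 (t • V) := by
  simp [gammaVW, expSO3_zero]

theorem isOneParameterSubgroup_gammaVW (V : so3) : IsOneParameterSubgroup (gammaVW (V, 0)) :=
  ⟨smoothCurve_gammaVW _, fun s t => by simp only [gammaVW_zero_right, expSO3_smul_mul]⟩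

theorem gammaVW_smul_smul (a b : ℝ) (X : so3) :
    gammaVW (a • X, b • X) = gammaVW ((a - b) • X, 0) := by
  funext t
  rw [gammaVW_zero_right, gammaVW]
  simp only [smul_smul, ← neg_smul]
  rw [expSO3_smul_mul]
  ring_nf

theorem leftVelocity_gammaVW_zero_right (v : Fin 3 → ℝ) (t : ℝ) :
    leftVelocity (gammaVW (hat v, 0)) t = hat v := by
  have := leftVelocity_gammaVW (hat v) (W := 0) (w := fun _ => v) (by simp)
    (fun t i => (hasDerivAt_const t (v i)).congr_deriv (by simp)) t
  rwa [map_zero] at this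

theorem IsOneParameterSubgroup.map_zero {γ : ℝ → SO3} (h : IsOneParameterSubgroup γ) :
    γ 0 = 1 := by
  have := h.2 0 0
  rw [add_zero] at this
  exact left_eq_mul.1 this

section

open scoped Matrix.Norms.Operator

/-- Differentiate γ(s) = γ(t) γ(s - t) at s = t. -/
theorem IsOneParameterSubgroup.leftVelocity_eq {γ : ℝ → SO3} (h : IsOneParameterSubgroup γ)
    (t : ℝ) : leftVelocity γ t = leftVelocity γ 0 := by
  apply SO3Geodesics.leftVelocity_eq h.1
  have h1 := ((hasDerivAt_curve h.1 0).const_mul (γ t : Matrix (Fin 3) (Fin 3) ℝ))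
  have h2 : HasDerivAt (fun s => (γ t : Matrix (Fin 3) (Fin 3) ℝ) * (γ (s - t) :
      Matrix (Fin 3) (Fin 3) ℝ)) ((γ t : Matrix (Fin 3) (Fin 3) ℝ) *
        ((γ 0 : Matrix (Fin 3) (Fin 3) ℝ) * (leftVelocity γ 0 : Matrix (Fin 3) (Fin 3) ℝ))) t :=
    HasDerivAt.comp_sub_const t t (by rw [sub_self]; exact h1)
  rw [h.map_zero, Submonoid.coe_one, one_mul] at h2
  convert! h2 using 2 with s
  rw [← Submonoid.coe_mul, ← h.2, add_sub_cancel]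

theorem IsOneParameterSubgroup.eq_gammaVW {γ : ℝ → SO3} (h : IsOneParameterSubgroup γ) :
    γ = gammaVW (leftVelocity γ 0, 0) := by
  funext t
  apply Subtype.ext
  have h1 := eq_mul_exp_of_hasDerivAt
    (fun t => by simpa only [h.leftVelocity_eq] using hasDerivAt_curve h.1 t) t
  rw [h1, h.map_zero, gammaVW_zero_right, Submonoid.coe_one, one_mul]
  rfl

end

theorem dotProduct_self_eq_sq_sqrt (v : Fin 3 → ℝ) : v ⬝ᵥ v = √(v ⬝ᵥ v) ^ 2 :=
  (Real.sq_sqrt (Finset.sum_nonneg fun i _ => mul_self_nonneg (v i))).symm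

theorem sqrt_dotProduct_self_pos {v : Fin 3 → ℝ} (hv : v ≠ 0) : 0 < √(v ⬝ᵥ v) :=
  Real.sqrt_pos.2 <| lt_of_le_of_ne (Finset.sum_nonneg fun i _ => mul_self_nonneg (v i))
    fun h => hv (dotProduct_self_eq_zero.1 h.symm)

theorem isLeast_period_gammaVW {v : Fin 3 → ℝ} (hv : v ≠ 0) :
    IsLeast {S : ℝ | 0 < S ∧ Function.Periodic (gammaVW (hat v, 0)) S}
      (2 * Real.pi / √(v ⬝ᵥ v)) := by
  have hr := sqrt_dotProduct_self_pos hv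
  have hpi := Real.pi_pos
  have key : ∀ S, Function.Periodic (gammaVW (hat v, 0)) S ↔
      ∃ n : ℤ, (n : ℝ) * (2 * Real.pi) = S * √(v ⬝ᵥ v) := fun S => by
    rw [periodic_gammaVW_iff, smul_zero, expSO3_zero,
      exp_eq_one_iff v hr.ne' (dotProduct_self_eq_sq_sqrt v)]
  refine ⟨⟨by positivity, (key _).2 ⟨1, by field_simp; simp⟩⟩, ?_⟩
  rintro S ⟨hS, hper⟩
  obtain ⟨n, hn⟩ := (key S).1 hper
  rw [div_le_iff₀ hr, ← hn]
  have h1 : (0 : ℝ) < n * (2 * Real.pi) := hn ▸ mul_pos hS hr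
  have h2 : (0 : ℝ) < n := pos_of_mul_pos_left h1 (by positivity)
  have h3 : (1 : ℝ) ≤ n := by exact_mod_cast h2
  nlinarith

/-- Serves Type I (c = α), Type II (c = A) and the bi-invariant case at once: speed √(2c)|v| times
period 2π/|v|. -/
theorem hasPrimitiveLength_gammaVW_zero_right {α A c : ℝ} (hα : 0 < α) (hA : 0 < A)
    {v : Fin 3 → ℝ} (hv : v ≠ 0) (hgeo : IsGeodesic (gNat α A) (gammaVW (hat v, 0)))
    (hc : gNat α A (hat v) (hat v) = 2 * c * (v ⬝ᵥ v)) (hc0 : 0 < c) :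
    HasPrimitiveLength (gNat α A) (gammaVW (hat v, 0)) (√c * ell0) := by
  refine ⟨_, isLeast_period_gammaVW hv, ?_⟩
  have hr := sqrt_dotProduct_self_pos hv
  rw [hgeo.arcLength_eq hα hA, leftVelocity_gammaVW_zero_right, hc,
    Real.sqrt_mul (by positivity), Real.sqrt_mul (by norm_num), ell0]
  field_simp

/-! ### The pairs in `𝔭` -/

theorem vec3_zero : (![0, 0, 0] : Fin 3 → ℝ) = 0 := by
  ext i
  fin_cases i <;> simp

/-- Translates the parameter z of 𝔭 into the initial velocity V - W, whose third coordinate is (Ā +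
α)z = α²z/(α-A). -/
theorem mk_eq_geodesicPair {α A : ℝ} (hα : 0 < α) (h : α ≠ A) (a b z : ℝ) :
    (hat ![a, b, Abar α A * z], hat ![0, 0, -α * z]) =
      geodesicPair α A ![a, b, α ^ 2 / (α - A) * z] := by
  have h' := sub_ne_zero.2 h
  rw [geodesicPair]
  congr 2
  · ext i
    fin_cases i <;> simp [Abar]
    field_simp
  · ext i
    fin_cases i <;> simp
    field_simp

theorem geodesicPair_mem_frakP {α A : ℝ} (hα : 0 < α) (h : α ≠ A) (v : Fin 3 → ℝ) :
    geodesicPair α A v ∈ frakP α A := by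
  have h' := sub_ne_zero.2 h
  refine mem_frakP.2 ⟨v 0, v 1, (α - A) / α ^ 2 * v 2, ?_⟩
  rw [mk_eq_geodesicPair hα h]
  congr 1
  ext i
  fin_cases i <;> simp
  field_simp

theorem exists_eq_geodesicPair {α A : ℝ} (hα : 0 < α) (h : α ≠ A) {VW : so3 × so3}
    (hVW : VW ∈ frakP α A) : ∃ v, VW = geodesicPair α A v := by
  obtain ⟨a, b, z, rfl⟩ := mem_frakP.1 hVW
  exact ⟨_, mk_eq_geodesicPair hα h a b z⟩

theorem geodesicPair_sub {α : ℝ} (hα : 0 < α) (A : ℝ) (v : Fin 3 → ℝ) :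
    (geodesicPair α A v).1 - (geodesicPair α A v).2 = hat v := by
  rw [geodesicPair, geodesicPair_fst hα, map_add, add_sub_cancel_right]

theorem geodesicPair_zero (α A : ℝ) : geodesicPair α A 0 = 0 := by
  simp [geodesicPair, vec3_zero]

theorem geodesicPair_of_sub_mul_eq_zero {α A : ℝ} (hα : 0 < α) {v : Fin 3 → ℝ}
    (h : (α - A) * v 2 = 0) : geodesicPair α A v = (hat v, 0) := by
  have h1 : (α - A) / α * v 2 = 0 := by rw [div_mul_eq_mul_div, h, zero_div]
  have h3 := geodesicPair_sub hα A v
  ext1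
  · simpa [geodesicPair, h1, vec3_zero] using h3
  · simp [geodesicPair, h1, vec3_zero]

theorem isTypeIII_iff {α A : ℝ} {p q : ℕ} {VW : so3 × so3} : IsTypeIII α A p q VW ↔
    0 < p ∧ 0 < q ∧ Nat.Coprime p q ∧ (q : ℝ) ^ 2 / (p : ℝ) ^ 2 > A ^ 2 / (A - α) ^ 2 ∧
      ∃ a b z : ℝ, a ^ 2 + b ^ 2 ≠ 0 ∧ z ≠ 0 ∧
        VW = (hat ![a, b, Abar α A * z], hat ![0, 0, -α * z]) ∧
        a ^ 2 + b ^ 2 = sigma p q α A * z ^ 2 := by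
  have hX : ∀ a b : ℝ, hat ![a, b, 0] = 0 ↔ a ^ 2 + b ^ 2 = 0 := fun a b => by
    rw [LinearEquiv.map_eq_zero_iff]
    constructor
    · intro h
      have h0 := congrFun h 0
      have h1 := congrFun h 1
      simp at h0 h1
      simp [h0, h1]
    · intro h
      have h0 : a = 0 := by nlinarith [sq_nonneg a, sq_nonneg b]
      have h1 : b = 0 := by nlinarith [sq_nonneg a, sq_nonneg b]
      ext i
      fin_cases i <;> simp [h0, h1]
  have hZ : ∀ z : ℝ, hat ![0, 0, z] = 0 ↔ z = 0 := fun z => by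
    rw [LinearEquiv.map_eq_zero_iff]
    constructor
    · intro h
      simpa using congrFun h 2
    · rintro rfl
      ext i
      fin_cases i <;> simp
  have hVW : ∀ a b z : ℝ, (hat ![a, b, 0] + Abar α A • hat ![0, 0, z], -(α • hat ![0, 0, z])) =
      (hat ![a, b, Abar α A * z], hat ![0, 0, -α * z]) := fun a b z => by
    simp [← map_smul, ← map_add, ← map_neg]
  have hg : ∀ a b z s : ℝ, g0 (hat ![a, b, 0]) (hat ![a, b, 0]) =
      s * g0 (hat ![0, 0, z]) (hat ![0, 0, z]) ↔ a ^ 2 + b ^ 2 = s * z ^ 2 := fun a b z s => by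
    rw [g0_hat, g0_hat]
    simp
    constructor <;> intro h <;> linarith
  rw [IsTypeIII]
  refine and_congr_right fun _ => and_congr_right fun _ => and_congr_right fun _ =>
    and_congr_right fun _ => ?_
  constructor
  · rintro ⟨X, hXm, Z, hZk, hX0, hZ0, h1, h2⟩
    obtain ⟨a, b, rfl⟩ := mem_frakM.1 hXm
    obtain ⟨z, rfl⟩ := mem_frakK.1 hZk
    exact ⟨a, b, z, mt (hX a b).2 hX0, mt (hZ z).2 hZ0, h1.trans (hVW a b z), (hg a b z _).1 h2⟩
  · rintro ⟨a, b, z, hab, hz, h1, h2⟩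
    exact ⟨_, mem_frakM.2 ⟨a, b, rfl⟩, _, mem_frakK.2 ⟨z, rfl⟩, mt (hX a b).1 hab,
      mt (hZ z).1 hz, h1.trans (hVW a b z).symm, (hg a b z _).2 h2⟩

/-! ### Types I and II -/

theorem gammaVW_mem_frakP1 {α A : ℝ} (hα : 0 < α) (hA : 0 < A) {VW : so3 × so3}
    (h : VW ∈ frakP1) : IsOneParameterSubgroup (gammaVW VW) ∧
      (VW ≠ 0 → HasPrimitiveLength (gNat α A) (gammaVW VW) (√α * ell0)) := by
  obtain ⟨a, b, rfl⟩ := mem_frakP1.1 h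
  refine ⟨isOneParameterSubgroup_gammaVW _, fun h0 => ?_⟩
  refine hasPrimitiveLength_gammaVW_zero_right hα hA ?_ ?_ ?_ hα
  · intro hv
    simp [hv] at h0
  · rw [← geodesicPair_of_sub_mul_eq_zero (A := A) hα (by simp)]
    exact (isGeodesic_gammaVW hα hA _).1
  · rw [gNat_hat, Matrix.vec3_dotProduct]
    simp
    ring

theorem gammaVW_mem_frakQ0 {α A : ℝ} (hα : 0 < α) (hA : 0 < A) (hne : α ≠ A) {VW : so3 × so3}
    (h : VW ∈ frakQ0 α A) : IsOneParameterSubgroup (gammaVW VW) ∧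
      (VW ≠ 0 → HasPrimitiveLength (gNat α A) (gammaVW VW) (√A * ell0)) := by
  obtain ⟨z, rfl⟩ := mem_frakQ0.1 h
  have h' := sub_ne_zero.2 hne
  have h1 : ∀ c : ℝ, hat ![0, 0, c * z] = c • hat ![0, 0, z] := fun c => by
    simp [← map_smul]
  have h2 : gammaVW (hat ![0, 0, Abar α A * z], hat ![0, 0, -α * z]) =
      gammaVW (hat ![0, 0, (Abar α A - -α) * z], 0) := by
    rw [h1, h1, h1, gammaVW_smul_smul]
  have h3 : Abar α A - -α = α ^ 2 / (α - A) := by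
    rw [Abar]
    field_simp
    ring
  refine ⟨h2 ▸ isOneParameterSubgroup_gammaVW _, fun h0 => ?_⟩
  have hgeo := (isGeodesic_gammaVW hα hA ![0, 0, α ^ 2 / (α - A) * z]).1
  rw [← mk_eq_geodesicPair hα hne, h2] at hgeo
  rw [h2]
  refine hasPrimitiveLength_gammaVW_zero_right hα hA ?_ hgeo ?_ hA
  · intro hv
    have hz := congrFun hv 2
    rw [h3] at hz
    have hz' : z = 0 := by simpa [h', hα.ne'] using hz
    apply h0
    rw [h1, h1, hz']
    simp [vec3_zero]
  · rw [gNat_hat, Matrix.vec3_dotProduct]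
    simp
    ring

/-! ### Type III -/

/-- For A < α both summands are positive. For A > α they compete, and integrality of p and q is
needed. -/
theorem typeIII_estimate {α A : ℝ} (hα : 0 < α) (hA : 0 < A) (hne : α ≠ A) {p q : ℕ} (hp : 0 < p)
    (h : (q : ℝ) ^ 2 / (p : ℝ) ^ 2 > A ^ 2 / (A - α) ^ 2) :
    (A < α ∧ (q : ℝ) ^ 2 < q ^ 2 + p ^ 2 * (A / (α - A)) ∧
        p ^ 2 * (A / (α - A)) < q ^ 2 + p ^ 2 * (A / (α - A))) ∨
      (p < q ∧ (q : ℝ) < q ^ 2 + p ^ 2 * (A / (α - A))) := by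
  have hp' : (0 : ℝ) < p := by exact_mod_cast hp
  have hq : (0 : ℝ) < q := by
    have h0 : 0 ≤ A ^ 2 / (A - α) ^ 2 := by positivity
    rcases Nat.eq_zero_or_pos q with rfl | hq
    · simp at h
      linarith
    · exact_mod_cast hq
  rcases lt_or_gt_of_ne hne with hlt | hlt
  · right
    have hd : 0 < A - α := sub_pos.2 hlt
    have hr : A / (α - A) = -(A / (A - α)) := by rw [← neg_sub, div_neg]
    set r := A / (A - α) with hrdef
    have hr1 : 1 < r := by
      rw [hrdef, one_lt_div hd]
      linarith
    have h1 : r < q / p := by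
      rw [← div_pow, ← div_pow, ← hrdef] at h
      exact lt_of_pow_lt_pow_left₀ 2 (by positivity) h
    rw [lt_div_iff₀ hp'] at h1
    have h2 : (p : ℝ) < q := by nlinarith
    have h3 : p < q := by exact_mod_cast h2
    refine ⟨h3, ?_⟩
    -- From pr < q it follows that q² - p²r > q² - pq = q(q - p) ≥ q.
    have h4 : (p : ℝ) + 1 ≤ q := by exact_mod_cast h3
    rw [hr]
    nlinarith
  · left
    have : 0 < A / (α - A) := div_pos hA (sub_pos.2 hlt)
    exact ⟨hlt, by nlinarith [pow_pos hp' 2], by nlinarith⟩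

theorem one_lt_typeIII {α A : ℝ} (hα : 0 < α) (hA : 0 < A) (hne : α ≠ A) {p q : ℕ} (hp : 0 < p)
    (hq : 0 < q) (h : (q : ℝ) ^ 2 / (p : ℝ) ^ 2 > A ^ 2 / (A - α) ^ 2) :
    1 < (q : ℝ) ^ 2 + p ^ 2 * (A / (α - A)) := by
  have hq' : (1 : ℝ) ≤ q := by exact_mod_cast hq
  rcases typeIII_estimate hα hA hne hp h with ⟨-, h1, -⟩ | ⟨-, h1⟩
  · nlinarith
  · linarith

theorem ell0_pos : 0 < ell0 := by
  rw [ell0]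
  positivity

theorem sqrt_mul_ell0_lt_lengthIII {α A : ℝ} (hα : 0 < α) (hA : 0 < A) (hne : α ≠ A) {p q : ℕ}
    (hp : 0 < p) (hq : 0 < q) (h : (q : ℝ) ^ 2 / (p : ℝ) ^ 2 > A ^ 2 / (A - α) ^ 2) :
    √α * ell0 < lengthIII α A p q := by
  have h1 : 1 < √((q : ℝ) ^ 2 + (p : ℝ) ^ 2 * (A / (α - A))) := by
    rw [Real.lt_sqrt (by norm_num)]
    simpa using one_lt_typeIII hα hA hne hp hq h
  exact lt_mul_of_one_lt_right (mul_pos (Real.sqrt_pos.2 hα) ell0_pos) h1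

theorem periodic_gammaVW_iff_of_ne_zero {a b c d r s T : ℝ} (hab : a ^ 2 + b ^ 2 ≠ 0) (hd : d ≠ 0)
    (hr : r ≠ 0) (hs : s ≠ 0) (hrv : a ^ 2 + b ^ 2 + c ^ 2 = r ^ 2) (hsd : d ^ 2 = s ^ 2) :
    Function.Periodic (gammaVW (hat ![a, b, c], hat ![0, 0, d])) T ↔
      (∃ m : ℤ, (m : ℝ) * (2 * Real.pi) = T * r) ∧ ∃ n : ℤ, (n : ℝ) * (2 * Real.pi) = T * s := by
  have h1 : ![a, b, c] ⬝ᵥ ![a, b, c] = r ^ 2 := by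
    rw [Matrix.vec3_dotProduct, ← hrv]
    simp
    ring
  have h2 : ![0, 0, d] ⬝ᵥ ![0, 0, d] = s ^ 2 := by
    rw [Matrix.vec3_dotProduct, ← hsd]
    simp
    ring
  rw [periodic_gammaVW_iff, ← exp_eq_one_iff _ hr h1, ← exp_eq_one_iff _ hs h2]
  constructor
  · intro h
    have h3 := exp_eq_one_of_exp_eq hr h1 hab hd h
    exact ⟨h3, h ▸ h3⟩
  · rintro ⟨h3, h4⟩
    rw [h3, h4]

theorem isLeast_period_of_coprime {p q : ℕ} (hp : 0 < p) (hpq : Nat.Coprime p q)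
    {s : ℝ} (hs : 0 < s) :
    IsLeast {T : ℝ | 0 < T ∧ (∃ m : ℤ, (m : ℝ) * (2 * Real.pi) = T * (q / p * s)) ∧
      ∃ n : ℤ, (n : ℝ) * (2 * Real.pi) = T * s} (2 * Real.pi * p / s) := by
  have hp' : (0 : ℝ) < p := by exact_mod_cast hp
  have hpi := Real.pi_pos
  refine ⟨⟨by positivity, ⟨q, ?_⟩, ⟨p, ?_⟩⟩, ?_⟩
  · push_cast
    field_simp
  · push_cast
    field_simp
  · rintro T ⟨hT, ⟨m, hm⟩, n, hn⟩
    -- Eliminating T gives mp = nq; coprimality then forces p ∣ n, so n ≥ p and T is at least the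
    -- claimed period.
    have h1 : (m : ℝ) * p = n * q := by
      have : (m * p : ℝ) * (2 * Real.pi) = (n * q) * (2 * Real.pi) := by
        calc (m * p : ℝ) * (2 * Real.pi) = (m * (2 * Real.pi)) * p := by ring
          _ = (T * s) * q := by rw [hm]; field_simp
          _ = (n * q) * (2 * Real.pi) := by rw [← hn]; ring
      exact mul_right_cancel₀ (by positivity) this
    have h2 : m * p = n * q := by exact_mod_cast h1
    have h3 : (p : ℤ) ∣ n := by
      have hc : IsCoprime (p : ℤ) (q : ℤ) := Nat.isCoprime_iff_coprime.2 hpq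
      exact hc.dvd_of_dvd_mul_right ⟨m, by rw [← h2, mul_comm]⟩
    have h4 : (0 : ℝ) < n := pos_of_mul_pos_left (hn ▸ mul_pos hT hs) (by positivity)
    have h5 : (p : ℤ) ≤ n := Int.le_of_dvd (by exact_mod_cast h4) h3
    have h6 : (p : ℝ) ≤ n := by exact_mod_cast h5
    rw [div_le_iff₀ hs, ← hn]
    nlinarith

/-- This is what σ is made for: ‖X‖² = σ‖Z‖² says exactly that |V| = (q/p)|W|, where |W| = α|z|. -/
theorem sigma_add_sq {α A : ℝ} {p q : ℕ} (z : ℝ) :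
    sigma p q α A * z ^ 2 + (Abar α A * z) ^ 2 = (q / p * (α * |z|)) ^ 2 := by
  rw [sigma, Abar, mul_pow (q / p : ℝ), mul_pow α, sq_abs, mul_pow _ z, div_pow, div_pow]
  ring

theorem IsTypeIII.hasPrimitiveLength {α A : ℝ} (hα : 0 < α) (hA : 0 < A) (hne : α ≠ A) {p q : ℕ}
    {VW : so3 × so3} (h : IsTypeIII α A p q VW) :
    HasPrimitiveLength (gNat α A) (gammaVW VW) (lengthIII α A p q) := by
  obtain ⟨hp, hq, hpq, hgt, a, b, z, hab, hz, rfl, hσ⟩ := isTypeIII_iff.1 h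
  have h' := sub_ne_zero.2 hne
  have hp' : (0 : ℝ) < p := by exact_mod_cast hp
  have hq' : (0 : ℝ) < q := by exact_mod_cast hq
  have hz' : 0 < |z| := abs_pos.2 hz
  have hs : 0 < α * |z| := mul_pos hα hz'
  refine ⟨2 * Real.pi * p / (α * |z|), ?_, ?_⟩
  · convert isLeast_period_of_coprime hp hpq hs using 1
    ext T
    exact and_congr_right fun _ => periodic_gammaVW_iff_of_ne_zero hab
      (mul_ne_zero (neg_ne_zero.2 hα.ne') hz) (by positivity) hs.ne'
      (by rw [hσ, sigma_add_sq]) (by rw [mul_pow, neg_sq, mul_pow, sq_abs])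
  · have hgeo := isGeodesic_gammaVW hα hA ![a, b, α ^ 2 / (α - A) * z]
    rw [← mk_eq_geodesicPair hα hne] at hgeo
    have hD := one_lt_typeIII hα hA hne hp hq hgt
    -- Written as a square times q² + p²A/(α-A), so that the root of the square cancels against the
    -- period 2πp/(α|z|).
    have hspeed : gNat α A (hat ![a, b, α ^ 2 / (α - A) * z]) (hat ![a, b, α ^ 2 / (α - A) * z]) =
        (√2 * √α * (α * |z|) / p) ^ 2 * ((q : ℝ) ^ 2 + (p : ℝ) ^ 2 * (A / (α - A))) := by
      have e1 : gNat α A (hat ![a, b, α ^ 2 / (α - A) * z]) (hat ![a, b, α ^ 2 / (α - A) * z]) =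
          2 * (α * (a ^ 2 + b ^ 2) + A * (α ^ 2 / (α - A) * z) ^ 2) := by
        rw [gNat_hat]
        simp
        ring
      rw [e1, hσ, sigma, div_pow, mul_pow, mul_pow, mul_pow, mul_pow α |z|, sq_abs, Real.sq_sqrt (by norm_num),
        Real.sq_sqrt hα.le]
      field_simp
      ring
    rw [hgeo.1.arcLength_eq hα hA, hgeo.2, hspeed, Real.sqrt_mul (by positivity),
      Real.sqrt_sq (by positivity), lengthIII, ell0]
    field_simp

theorem IsTypeIII.not_isOneParameterSubgroup {α A : ℝ} (hα : 0 < α) (hA : 0 < A) (hne : α ≠ A)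
    {p q : ℕ} {VW : so3 × so3} (h : IsTypeIII α A p q VW) :
    ¬ IsOneParameterSubgroup (gammaVW VW) := by
  obtain ⟨hp, hq, hpq, hgt, a, b, z, hab, hz, rfl, hσ⟩ := isTypeIII_iff.1 h
  intro hone
  have h' := sub_ne_zero.2 hne
  have hgeo := isGeodesic_gammaVW hα hA ![a, b, α ^ 2 / (α - A) * z]
  rw [← mk_eq_geodesicPair hα hne] at hgeo
  -- A one-parameter subgroup has constant left velocity, so the Euler field must vanish there; with
  -- z ≠ 0 this forces a = b = 0.
  have hd := ((isGeodesic_iff hα hA).1 hgeo.1).2 0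
  simp only [bodyVelocity, hone.leftVelocity_eq] at hd
  rw [hgeo.2, LinearEquiv.symm_apply_apply] at hd
  have h0 := (hd 0).unique (hasDerivAt_const _ _)
  have h1 := (hd 1).unique (hasDerivAt_const _ _)
  simp [eulerField, h', hα.ne', hz] at h0 h1
  simp [h0, h1] at hab

theorem exists_isTypeIII {α A : ℝ} (hα : 0 < α) {p q : ℕ} (hp : 0 < p) (hq : 0 < q)
    (hpq : Nat.Coprime p q) (h : (q : ℝ) ^ 2 / (p : ℝ) ^ 2 > A ^ 2 / (A - α) ^ 2) :
    ∃ VW ∈ frakP α A, IsTypeIII α A p q VW := by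
  have hσ : 0 < sigma p q α A := by
    have e : sigma p q α A = α ^ 2 * ((q : ℝ) ^ 2 / p ^ 2 - A ^ 2 / (A - α) ^ 2) := by
      rw [sigma, ← neg_sub A α, neg_sq]
      ring
    rw [e]
    exact mul_pos (by positivity) (sub_pos.2 h)
  refine ⟨_, mem_frakP.2 ⟨√(sigma p q α A), 0, 1, rfl⟩,
    isTypeIII_iff.2 ⟨hp, hq, hpq, h, _, _, _, ?_, one_ne_zero, rfl, ?_⟩⟩
  · rw [Real.sq_sqrt hσ.le]
    simpa using hσ.ne'
  · rw [Real.sq_sqrt hσ.le]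
    simp

theorem type_of_periodic {α A : ℝ} (hα : 0 < α) {VW : so3 × so3} (hVW : VW ∈ frakP α A) {T : ℝ}
    (hT : 0 < T) (hper : Function.Periodic (gammaVW VW) T) :
    VW ∈ frakP1 ∨ VW ∈ frakQ0 α A ∨ ∃ p q : ℕ, IsTypeIII α A p q VW := by
  obtain ⟨a, b, z, rfl⟩ := mem_frakP.1 hVW
  have hpi := Real.pi_pos
  by_cases hab : a ^ 2 + b ^ 2 = 0
  · right; left
    have ha : a = 0 := by nlinarith [sq_nonneg a, sq_nonneg b]
    have hb : b = 0 := by nlinarith [sq_nonneg a, sq_nonneg b]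
    exact mem_frakQ0.2 ⟨z, by rw [ha, hb]⟩
  by_cases hz : z = 0
  · left
    refine mem_frakP1.2 ⟨a, b, ?_⟩
    simp [hz, vec3_zero]
  right; right
  have hab' : 0 < a ^ 2 + b ^ 2 := lt_of_le_of_ne (by positivity) (Ne.symm hab)
  have hs : 0 < α * |z| := mul_pos hα (abs_pos.2 hz)
  set r := √(a ^ 2 + b ^ 2 + (Abar α A * z) ^ 2) with hr
  have hr2 : a ^ 2 + b ^ 2 + (Abar α A * z) ^ 2 = r ^ 2 := (Real.sq_sqrt (by positivity)).symm
  have hr0 : 0 < r := Real.sqrt_pos.2 (by positivity)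
  obtain ⟨⟨m, hm⟩, n, hn⟩ := (periodic_gammaVW_iff_of_ne_zero hab
    (mul_ne_zero (neg_ne_zero.2 hα.ne') hz) hr0.ne' hs.ne' hr2
    (by rw [mul_pow, neg_sq, mul_pow, sq_abs])).1 hper
  have hm0 : (0 : ℝ) < m := pos_of_mul_pos_left (hm ▸ mul_pos hT hr0) (by positivity)
  have hn0 : (0 : ℝ) < n := pos_of_mul_pos_left (hn ▸ mul_pos hT hs) (by positivity)
  lift m to ℕ using by exact_mod_cast hm0.le
  lift n to ℕ using by exact_mod_cast hn0.le
  simp only [Int.cast_natCast] at hm hn hm0 hn0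
  -- Over time T the factors exp(tV) and exp(tW) make m and n full turns, so q/p is m/n in lowest
  -- terms.
  obtain ⟨p, q, hpq, hp, hq⟩ := Nat.exists_coprime n m
  set d := Nat.gcd n m
  have hp0 : 0 < p := Nat.pos_of_ne_zero fun h => by simp [hp, h] at hn0
  have hq0 : 0 < q := Nat.pos_of_ne_zero fun h => by simp [hq, h] at hm0
  have hd0 : 0 < d := Nat.pos_of_ne_zero fun h => by simp [hp, h] at hn0
  have hp' : (0 : ℝ) < p := by exact_mod_cast hp0
  have hd' : (0 : ℝ) < d := by exact_mod_cast hd0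
  have hrs : r = q / p * (α * |z|) := by
    rw [hq] at hm
    rw [hp] at hn
    push_cast at hm hn
    have h1 : (T * d) * (r * p) = (T * d) * (q * (α * |z|)) := by
      linear_combination (-(d * p : ℝ)) * hm + (d * q : ℝ) * hn
    have h2 := mul_left_cancel₀ (by positivity) h1
    field_simp
    linarith
  have key : a ^ 2 + b ^ 2 = sigma p q α A * z ^ 2 := by
    have := sigma_add_sq (α := α) (A := A) (p := p) (q := q) z
    rw [← hrs, ← hr2] at this
    linarith
  refine ⟨p, q, isTypeIII_iff.2 ⟨hp0, hq0, hpq, ?_, a, b, z, hab, hz, rfl, key⟩⟩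
  have e : sigma p q α A * z ^ 2 = (α * z) ^ 2 * ((q : ℝ) ^ 2 / p ^ 2 - A ^ 2 / (A - α) ^ 2) := by
    rw [sigma, ← neg_sub A α, neg_sq]
    ring
  rw [key, e] at hab'
  exact sub_pos.1 (pos_of_mul_pos_right hab' (by positivity))

theorem div_sq_gt_iff {α A : ℝ} {p q : ℕ} :
    (q : ℝ) ^ 2 / (p : ℝ) ^ 2 > A ^ 2 / (A - α) ^ 2 ↔ (q : ℝ) / (p : ℝ) > |A / (A - α)| := by
  rw [← div_pow, ← div_pow, gt_iff_lt, sq_lt_sq, abs_of_nonneg (a := (q / p : ℝ)) (by positivity)]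

/-! ### The length spectrum -/

theorem HasPrimitiveLength.mem_lengthSpectrum {α A : ℝ} (hα : 0 < α) (hA : 0 < A) {γ : ℝ → SO3}
    (h : IsGeodesic (gNat α A) γ) {L : ℝ} (hL : HasPrimitiveLength (gNat α A) γ L) {k : ℕ}
    (hk : 0 < k) : k * L ∈ lengthSpectrum (gNat α A) := by
  obtain ⟨T, ⟨⟨hT, hper⟩, -⟩, rfl⟩ := hL
  refine ⟨γ, k * T, h, mul_pos (by exact_mod_cast hk) hT, hper.nat_mul k, ?_⟩
  rw [h.arcLength_eq hα hA, h.arcLength_eq hα hA, mul_assoc]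

theorem gammaVW_zero_pair (t : ℝ) : gammaVW 0 t = 1 := by
  simp [gammaVW, expSO3_zero]

theorem isGeodesic_gammaVW_zero {α A : ℝ} (hα : 0 < α) (hA : 0 < A) :
    IsGeodesic (gNat α A) (gammaVW 0) := by
  rw [← geodesicPair_zero α A]
  exact (isGeodesic_gammaVW hα hA 0).1

theorem arcLength_gammaVW_zero {α A : ℝ} (hα : 0 < α) (hA : 0 < A) (T : ℝ) :
    arcLength (gNat α A) (gammaVW 0) 0 T = 0 := by
  have h := isGeodesic_gammaVW hα hA 0
  rw [geodesicPair_zero, map_zero] at h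
  rw [h.1.arcLength_eq hα hA, h.2]
  simp

theorem zero_mem_lengthSpectrum {α A : ℝ} (hα : 0 < α) (hA : 0 < A) :
    0 ∈ lengthSpectrum (gNat α A) :=
  ⟨gammaVW 0, 1, isGeodesic_gammaVW_zero hα hA, one_pos,
    fun t => by simp only [gammaVW_zero_pair], arcLength_gammaVW_zero hα hA 1⟩

theorem HasPrimitiveLength.nat_mul_mem_lengthSpectrum {α A : ℝ} (hα : 0 < α) (hA : 0 < A)
    {γ : ℝ → SO3} (h : IsGeodesic (gNat α A) γ) {L : ℝ} (hL : HasPrimitiveLength (gNat α A) γ L)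
    (k : ℕ) : k * L ∈ lengthSpectrum (gNat α A) := by
  -- For k = 0 the time kT would not be positive; the length 0 comes from a constant geodesic
  -- instead.
  rcases Nat.eq_zero_or_pos k with rfl | hk
  · simpa using zero_mem_lengthSpectrum hα hA
  · exact hL.mem_lengthSpectrum hα hA h hk

/-- Up to left translation, closed geodesics start at the identity. -/
theorem exists_of_mem_lengthSpectrum {α A : ℝ} (hα : 0 < α) (hA : 0 < A) {L : ℝ}
    (hL : L ∈ lengthSpectrum (gNat α A)) :
    ∃ (v : Fin 3 → ℝ) (T : ℝ), 0 < T ∧ Function.Periodic (gammaVW (geodesicPair α A v)) T ∧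
      arcLength (gNat α A) (gammaVW (geodesicPair α A v)) 0 T = L := by
  obtain ⟨γ, T, hγ, hT, hper, rfl⟩ := hL
  have h := (hγ.mul_left hα hA (γ 0)⁻¹).eq_gammaVW hα hA (inv_mul_cancel _)
  refine ⟨_, T, hT, h ▸ (periodic_mul_left_iff _).2 hper, ?_⟩
  rw [← h]
  exact arcLength_mul_left _ _ hγ.1 0 T

theorem calE_finite {α A : ℝ} (hα : 0 < α) (hA : 0 < A) (hne : α ≠ A) (τ : ℝ) :
    (calE τ α A).Finite := by
  set K := (τ / (√α * ell0)) ^ 2 with hK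
  -- K is the value of q² + p²A/(α-A) prescribed by τ. The second entry of the maximum bounds p when
  -- A < α; when A > α the bound K suffices, since p < q < K.
  set N := ⌈max K (K / (A / (α - A)))⌉₊
  refine ((Set.finite_Iic N).prod (Set.finite_Iic N)).subset ?_
  rintro ⟨p, q⟩ ⟨hp, hq, -, hgt, hlen⟩
  simp only at hp hq hgt hlen
  have hgt' := div_sq_gt_iff.2 hgt
  have hc : 0 < √α * ell0 := mul_pos (Real.sqrt_pos.2 hα) ell0_pos
  have hD : (q : ℝ) ^ 2 + p ^ 2 * (A / (α - A)) = K := by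
    have h1 := one_lt_typeIII hα hA hne hp hq hgt'
    rw [hK, ← hlen, lengthIII, mul_div_cancel_left₀ _ hc.ne', Real.sq_sqrt (by linarith)]
  have hp1 : (1 : ℝ) ≤ p := by exact_mod_cast hp
  have hq1 : (1 : ℝ) ≤ q := by exact_mod_cast hq
  have hN : ∀ n : ℕ, ((n : ℝ) ≤ K ∨ (n : ℝ) ≤ K / (A / (α - A))) → n ≤ N := fun n hn => by
    have : (n : ℝ) ≤ N := (le_max_iff.2 hn).trans (Nat.le_ceil _)
    exact_mod_cast this
  rcases typeIII_estimate hα hA hne hp hgt' with ⟨hlt, h1, h2⟩ | ⟨hlt, h1⟩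
  · have hpos : 0 < A / (α - A) := div_pos hA (sub_pos.2 hlt)
    refine ⟨hN p (Or.inr ?_), hN q (Or.inl ?_)⟩
    · rw [le_div_iff₀ hpos]
      nlinarith
    · nlinarith
  · have hqN := hN q (Or.inl (by linarith))
    exact ⟨hlt.le.trans hqN, hqN⟩

/-! ### The bi-invariant case -/

theorem geodesicPair_self {A : ℝ} (hA : 0 < A) (v : Fin 3 → ℝ) :
    geodesicPair A A v = (hat v, 0) :=
  geodesicPair_of_sub_mul_eq_zero hA (by simp)

theorem isGeodesic_gammaVW_self {A : ℝ} (hA : 0 < A) (v : Fin 3 → ℝ) :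
    IsGeodesic (gNat A A) (gammaVW (hat v, 0)) := by
  rw [← geodesicPair_self hA]
  exact (isGeodesic_gammaVW hA hA v).1

theorem hasPrimitiveLength_self {A : ℝ} (hA : 0 < A) {v : Fin 3 → ℝ} (hv : v ≠ 0) :
    HasPrimitiveLength (gNat A A) (gammaVW (hat v, 0)) (√A * ell0) :=
  hasPrimitiveLength_gammaVW_zero_right hA hA hv (isGeodesic_gammaVW_self hA v)
    (by rw [gNat_hat, Matrix.vec3_dotProduct]; ring) hA

theorem isClosedGeodesic_iff_isOneParameterSubgroup {A : ℝ} (hA : 0 < A) (γ : ℝ → SO3) :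
    (IsClosedGeodesic (gNat A A) γ ∧ γ 0 = 1) ↔ IsOneParameterSubgroup γ := by
  constructor
  · rintro ⟨⟨hγ, -⟩, h0⟩
    rw [hγ.eq_gammaVW hA hA h0, geodesicPair_self hA]
    exact isOneParameterSubgroup_gammaVW _
  · intro h
    refine ⟨?_, h.map_zero⟩
    rw [h.eq_gammaVW, ← hat_bodyVelocity]
    -- The constant curve has no least positive period and is treated apart.
    rcases eq_or_ne (bodyVelocity γ 0) 0 with hv | hv
    · rw [hv, map_zero]
      exact ⟨isGeodesic_gammaVW_zero hA hA, 1, one_pos,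
        fun t => (gammaVW_zero_pair _).trans (gammaVW_zero_pair _).symm⟩
    · exact (hasPrimitiveLength_self hA hv).isClosedGeodesic (isGeodesic_gammaVW_self hA _)

theorem IsGeodesic.hasPrimitiveLength_self {A : ℝ} (hA : 0 < A) {γ : ℝ → SO3}
    (hγ : IsGeodesic (gNat A A) γ) (hne : ∃ t, γ t ≠ γ 0) :
    HasPrimitiveLength (gNat A A) γ (√A * ell0) := by
  rw [← hasPrimitiveLength_mul_left_iff _ (γ 0)⁻¹ hγ.1]
  have h := (hγ.mul_left hA hA (γ 0)⁻¹).eq_gammaVW hA hA (inv_mul_cancel _)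
  rw [geodesicPair_self hA] at h
  set v := bodyVelocity (fun t => (γ 0)⁻¹ * γ t) 0
  rw [h]
  refine SO3Geodesics.hasPrimitiveLength_self hA fun hv => ?_
  obtain ⟨t, ht⟩ := hne
  have h1 := congrFun h t
  rw [hv, map_zero] at h1
  exact ht (inv_mul_eq_one.1 (h1.trans (gammaVW_zero_pair t))).symm

theorem lengthSpectrum_self {A : ℝ} (hA : 0 < A) :
    lengthSpectrum (gNat A A) = {0} ∪ {L | ∃ k : ℕ, L = k * (√A * ell0)} := by
  ext L
  constructor
  · intro hL
    obtain ⟨v, T, hT, hper, rfl⟩ := exists_of_mem_lengthSpectrum hA hA hL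
    rcases eq_or_ne v 0 with rfl | hv
    · left
      rw [geodesicPair_zero]
      exact arcLength_gammaVW_zero hA hA T
    · right
      rw [geodesicPair_self hA] at hper ⊢
      exact (hasPrimitiveLength_self hA hv).exists_nat_mul hA hA (isGeodesic_gammaVW_self hA v)
        hT hper
  · rintro (rfl | ⟨k, rfl⟩)
    · exact zero_mem_lengthSpectrum hA hA
    · exact (hasPrimitiveLength_self hA one_ne_zero).nat_mul_mem_lengthSpectrum hA hA
        (isGeodesic_gammaVW_self hA _) k

/-! ### The case `α ≠ A` -/

theorem frakP1_le_frakP (α A : ℝ) : frakP1 ≤ frakP α A := le_sup_left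

theorem frakQ0_le_frakP (α A : ℝ) : frakQ0 α A ≤ frakP α A := le_sup_right

theorem isGeodesic_of_mem_frakP {α A : ℝ} (hα : 0 < α) (hA : 0 < A) (hne : α ≠ A)
    {VW : so3 × so3} (h : VW ∈ frakP α A) :
    IsGeodesic (gNat α A) (gammaVW VW) ∧ leftVelocity (gammaVW VW) 0 = VW.1 - VW.2 := by
  obtain ⟨v, rfl⟩ := exists_eq_geodesicPair hα hne h
  rw [geodesicPair_sub hα]
  exact isGeodesic_gammaVW hα hA v

/-- Uniqueness holds because the pair is determined by V - W, the initial left velocity of its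
curve. -/
theorem existsUnique_gammaVW {α A : ℝ} (hα : 0 < α) (hA : 0 < A) (hne : α ≠ A) {γ : ℝ → SO3}
    (hγ : IsGeodesic (gNat α A) γ) (h0 : γ 0 = 1) : ∃! VW, VW ∈ frakP α A ∧ γ = gammaVW VW := by
  refine ⟨geodesicPair α A (bodyVelocity γ 0),
    ⟨geodesicPair_mem_frakP hα hne _, hγ.eq_gammaVW hα hA h0⟩, ?_⟩
  rintro VW ⟨hVW, rfl⟩
  obtain ⟨v, rfl⟩ := exists_eq_geodesicPair hα hne hVW
  rw [bodyVelocity, (isGeodesic_gammaVW hα hA v).2, LinearEquiv.symm_apply_apply]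

theorem isClosedGeodesic_gammaVW_iff {α A : ℝ} (hα : 0 < α) (hA : 0 < A) (hne : α ≠ A)
    {VW : so3 × so3} (hVW : VW ∈ frakP α A) : IsClosedGeodesic (gNat α A) (gammaVW VW) ↔
      (VW ∈ frakP1 ∨ VW ∈ frakQ0 α A ∨ ∃ p q : ℕ, IsTypeIII α A p q VW) := by
  have hgeo := (isGeodesic_of_mem_frakP hα hA hne hVW).1
  constructor
  · rintro ⟨-, T, hT, hper⟩
    exact type_of_periodic hα hVW hT hper
  · intro h
    rcases eq_or_ne VW 0 with rfl | h0
    · exact ⟨hgeo, 1, one_pos, fun t => (gammaVW_zero_pair _).trans (gammaVW_zero_pair _).symm⟩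
    rcases h with h | h | ⟨p, q, h⟩
    · exact ((gammaVW_mem_frakP1 hα hA h).2 h0).isClosedGeodesic hgeo
    · exact ((gammaVW_mem_frakQ0 hα hA hne h).2 h0).isClosedGeodesic hgeo
    · exact (h.hasPrimitiveLength hα hA hne).isClosedGeodesic hgeo

theorem lengthSpectrum_of_ne {α A : ℝ} (hα : 0 < α) (hA : 0 < A) (hne : α ≠ A) :
    lengthSpectrum (gNat α A) =
      {0} ∪ {L | ∃ k : ℕ, L = k * (√α * ell0)} ∪ {L | ∃ k : ℕ, L = k * (√A * ell0)} ∪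
        {L | ∃ (k : ℕ) (τ : ℝ), 0 < τ ∧ (calE τ α A).Nonempty ∧ L = k * τ} := by
  ext L
  constructor
  · intro hL
    obtain ⟨v, T, hT, hper, rfl⟩ := exists_of_mem_lengthSpectrum hα hA hL
    have hVW := geodesicPair_mem_frakP hα hne v
    generalize geodesicPair α A v = VW at *
    have hgeo := (isGeodesic_of_mem_frakP hα hA hne hVW).1
    rcases eq_or_ne VW 0 with rfl | h0
    · exact Or.inl (Or.inl (Or.inl (arcLength_gammaVW_zero hα hA T)))
    rcases type_of_periodic hα hVW hT hper with h | h | ⟨p, q, h⟩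
    · exact Or.inl (Or.inl (Or.inr
        (((gammaVW_mem_frakP1 hα hA h).2 h0).exists_nat_mul hα hA hgeo hT hper)))
    · exact Or.inl (Or.inr
        (((gammaVW_mem_frakQ0 hα hA hne h).2 h0).exists_nat_mul hα hA hgeo hT hper))
    · right
      obtain ⟨k, hk⟩ := (h.hasPrimitiveLength hα hA hne).exists_nat_mul hα hA hgeo hT hper
      obtain ⟨hp, hq, hpq, hgt, -⟩ := h
      have hpos : 0 < lengthIII α A p q :=
        (mul_pos (Real.sqrt_pos.2 hα) ell0_pos).trans
          (sqrt_mul_ell0_lt_lengthIII hα hA hne hp hq hgt)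
      exact ⟨k, _, hpos, ⟨(p, q), hp, hq, hpq, div_sq_gt_iff.1 hgt, rfl⟩, hk⟩
  · have hv : ∀ x y : ℝ, x ≠ 0 ∨ y ≠ 0 → ![x, 0, y] ≠ 0 := fun x y hxy h => by
      have h0 := congrFun h 0
      have h2 := congrFun h 2
      simp at h0 h2
      simp [h0, h2] at hxy
    rintro (((rfl | ⟨k, rfl⟩) | ⟨k, rfl⟩) | ⟨k, τ, -, ⟨⟨p, q⟩, hp, hq, hpq, hgt, rfl⟩, rfl⟩)
    · exact zero_mem_lengthSpectrum hα hA
    · have hmem : ((hat ![1, 0, 0], 0) : so3 × so3) ∈ frakP1 := mem_frakP1.2 ⟨1, 0, rfl⟩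
      refine ((gammaVW_mem_frakP1 hα hA hmem).2 fun h => ?_).nat_mul_mem_lengthSpectrum hα hA
        (isGeodesic_of_mem_frakP hα hA hne (frakP1_le_frakP α A hmem)).1 k
      exact hv 1 0 (by simp) ((LinearEquiv.map_eq_zero_iff hat).1 (congrArg Prod.fst h))
    · have hmem := (mem_frakQ0 (α := α) (A := A)).2 ⟨1, rfl⟩
      refine ((gammaVW_mem_frakQ0 hα hA hne hmem).2 fun h => ?_).nat_mul_mem_lengthSpectrum hα hA
        (isGeodesic_of_mem_frakP hα hA hne (frakQ0_le_frakP α A hmem)).1 k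
      exact hv 0 (-α * 1) (by simp [hα.ne'])
        ((LinearEquiv.map_eq_zero_iff hat).1 (congrArg Prod.snd h))
    · obtain ⟨VW, hVW, h⟩ := exists_isTypeIII hα hp hq hpq (div_sq_gt_iff.2 hgt)
      exact (h.hasPrimitiveLength hα hA hne).nat_mul_mem_lengthSpectrum hα hA
        (isGeodesic_of_mem_frakP hα hA hne hVW).1 k

end SO3Geodesics

end

theorem theorem4p5 (α A : ℝ) (hα : 0 < α) (hA : 0 < A) :
    -- the bi-invariant case
    (α = A →
      (∀ γ : ℝ → SO3,
        (IsClosedGeodesic (gNat α A) γ ∧ γ 0 = 1) ↔ IsOneParameterSubgroup γ) ∧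
      (∀ γ : ℝ → SO3, IsClosedGeodesic (gNat α A) γ → (∃ t, γ t ≠ γ 0) →
        HasPrimitiveLength (gNat α A) γ (√A * ell0))) ∧
    -- the case `α ≠ A`
    (α ≠ A →
      -- the curves `γ_{(V,W)}`, `(V,W) ∈ 𝔭`, are the geodesics through the identity
      (∀ VW ∈ frakP α A, IsGeodesic (gNat α A) (gammaVW VW) ∧ gammaVW VW 0 = 1 ∧
        leftVelocity (gammaVW VW) 0 = VW.1 - VW.2) ∧
      (∀ γ : ℝ → SO3, IsGeodesic (gNat α A) γ → γ 0 = 1 →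
        ∃! VW, VW ∈ frakP α A ∧ γ = gammaVW VW) ∧
      -- which of them are closed
      (∀ VW ∈ frakP α A, IsClosedGeodesic (gNat α A) (gammaVW VW) ↔
        (VW ∈ frakP1 ∨ VW ∈ frakQ0 α A ∨ ∃ p q : ℕ, IsTypeIII α A p q VW)) ∧
      -- the three types
      (∀ VW ∈ frakP1, IsOneParameterSubgroup (gammaVW VW) ∧
        (VW ≠ 0 → HasPrimitiveLength (gNat α A) (gammaVW VW) (√α * ell0))) ∧
      (∀ VW ∈ frakQ0 α A, IsOneParameterSubgroup (gammaVW VW) ∧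
        (VW ≠ 0 → HasPrimitiveLength (gNat α A) (gammaVW VW) (√A * ell0))) ∧
      (∀ (VW : so3 × so3) (p q : ℕ), IsTypeIII α A p q VW →
        ¬ IsOneParameterSubgroup (gammaVW VW) ∧
        HasPrimitiveLength (gNat α A) (gammaVW VW) (lengthIII α A p q) ∧
        √α * ell0 < lengthIII α A p q)) ∧
    -- the length spectrum
    (α = A → lengthSpectrum (gNat α A) = {0} ∪ {L | ∃ k : ℕ, L = k * (√α * ell0)}) ∧
    (α ≠ A → lengthSpectrum (gNat α A) =
      {0} ∪ {L | ∃ k : ℕ, L = k * (√α * ell0)} ∪ {L | ∃ k : ℕ, L = k * (√A * ell0)} ∪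
        {L | ∃ (k : ℕ) (τ : ℝ), 0 < τ ∧ (calE τ α A).Nonempty ∧ L = k * τ}) ∧
    -- finiteness
    (α ≠ A → ∀ τ : ℝ, 0 < τ → (calE τ α A).Finite) := by
  refine ⟨?_, fun hne => ⟨?_, ?_, ?_, ?_, ?_, ?_⟩, ?_, lengthSpectrum_of_ne hα hA,
    fun hne τ _ => calE_finite hα hA hne τ⟩
  · rintro rfl
    exact ⟨isClosedGeodesic_iff_isOneParameterSubgroup hA,
      fun γ hγ => hγ.1.hasPrimitiveLength_self hA⟩
  · intro VW hVW
    have h := isGeodesic_of_mem_frakP hα hA hne hVW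
    exact ⟨h.1, gammaVW_zero VW, h.2⟩
  · exact fun γ => existsUnique_gammaVW hα hA hne
  · exact fun VW => isClosedGeodesic_gammaVW_iff hα hA hne
  · exact fun VW => gammaVW_mem_frakP1 hα hA
  · exact fun VW => gammaVW_mem_frakQ0 hα hA hne
  · exact fun VW p q h => ⟨h.not_isOneParameterSubgroup hα hA hne,
      h.hasPrimitiveLength hα hA hne, sqrt_mul_ell0_lt_lengthIII hα hA hne h.1 h.2.1 h.2.2.2.1⟩
  · rintro rfl
    exact lengthSpectrum_self hA
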